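/- Let $k$ be a differential field of characteristic $0$ with commuting derivations $\delta_1,\dots,\delta_m$, let $k\{Y\}$, $Y=\{y_1,\dots,y_n\}$, be the ring of differential polynomials over $k$, i.e. the polynomial ring over $k$ in the set $\Theta Y$ of all derivatives $\theta y_j$, where $\theta$ runs through the monoid $\Theta$ of derivative operators $\delta_1^{k_1}\cdots\delta_m^{k_m}$. Fix a ranking on $\Theta Y$, i.e. a total order with $\theta u\ge u$, and $u\ge v\Rightarrow \theta u\ge\theta v$. For $f\in k\{Y\}\setminus k$, the leader $\mathrm{ld}\,f$ is the highest derivative $u$ in $f$, the rank of $f$ is $\mathrm{rk}\,f=u^d$ with $d=\deg_u f$, and the initial of $f$ is the coefficient of $u^d$ in $f$; ranks are ordered first by $u$, then by $d$. A polynomial $f$ is algebraically reduced w.r.t. $g$ if $\deg_{\mathrm{ld}\,g} f<\deg_{\mathrm{ld}\,g} g$, and reduced w.r.t. $g$ if, moreover, no proper derivative of $\mathrm{ld}\,g$ appears in $f$. A subset of $k\{Y\}\setminus k$ is autoreduced (algebraically autoreduced) if each element is reduced (algebraically reduced) w.r.t. all the others; it is weak d-triangular if the leaders of its elements are distinct and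 none of them is a derivative of another one. A set $\mathbb A$ has lower rank than $\mathbb B$ if there is $f\in\mathbb A$ such that no element of $\mathbb B$ has rank $\mathrm{rk}\,f$, and $\mathbb A$ and $\mathbb B$ have the same ranks below $\mathrm{rk}\,f$ (for finite autoreduced sets, listed by increasing rank, this is the usual comparison of rank sequences: the first difference decides, and a proper extension of a sequence is lower than the sequence). A characteristic set (algebraic characteristic set) of $X\subseteq k\{Y\}$ is an autoreduced (algebraically autoreduced) subset of $X$ of the lowest rank. A characteristic set $\mathbb A$ of $X$ is canonical if, for each $f\in\mathbb A$, the initial of $f$ lies in $k[N]$, $f$ is monic (its leading coefficient is $1$ for the lexicographic monomial order induced by the ranking) and $f$ has no factors in $k[N]\setminus k$, where $N=\Theta Y\setminus\Theta\,\mathrm{ld}\,\mathbb A$; an algebraic characteristic set $\mathbb A$ of a subset of $k[V]$, $V\subseteq\Theta Y$, is canonical if the same holds with $N=V\setminus\mathrm{ld}\,\mathbb A$. Let $I$ be a prime differential ideal of $k\{Y\}$, let $\mathbb C$ be the canonical characteristic set of $I$, and let $V\subseteq\Theta Y$ be such that $J=I\cap k[V]$ contains $\mathbb C$. Then $J$ has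 exactly one canonical algebraic characteristic set $\mathbb D$, it contains $\mathbb C$, and $\mathbb C$ is the weak d-triangular subset of $\mathbb D$ of the least rank, i.e. $\mathbb C$ is a weak d-triangular subset of $\mathbb D$ of the least rank and is the only one. -/

import Mathlib

noncomputable section

namespace DiffAlg

open MvPolynomial

/-- The derivative `δ₁^(k₁) ⋯ δₘ^(kₘ) y_j`, an element of `ΘY`.  Here `op` is the exponent vector
`(k₁, …, kₘ)` of the derivative operator and `var` is the index `j` of the differential
indeterminate. -/
@[ext]
structure Deriv (m n : ℕ) where
  op : Fin m →₀ ℕ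
  var : Fin n

/-- The action `θ₁ (θ₂ y_j) = (θ₁ θ₂) y_j` of derivative operators on derivatives; the monoid `Θ`
is written additively, through exponent vectors. -/
def act {m n : ℕ} (θ : Fin m →₀ ℕ) (u : Deriv m n) : Deriv m n := ⟨θ + u.op, u.var⟩

/-- The set `ΘS` of all derivatives of the elements of a set `S` of derivatives. -/
def derivsOf {m n : ℕ} (S : Set (Deriv m n)) : Set (Deriv m n) :=
  {v | ∃ u ∈ S, ∃ θ : Fin m →₀ ℕ, v = act θ u}

/-- `v` is a proper derivative of `u`: `v = θ u` with `θ ≠ 1`. -/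
def IsProperDerivative {m n : ℕ} (v u : Deriv m n) : Prop :=
  ∃ θ : Fin m →₀ ℕ, θ ≠ 0 ∧ v = act θ u

/-- A linear order on `ΘY` is a ranking if `θ u ≥ u`, and `u ≥ v` implies `θ u ≥ θ v`. -/
structure IsRanking (m n : ℕ) [LinearOrder (Deriv m n)] : Prop where
  le_act : ∀ (θ : Fin m →₀ ℕ) (u : Deriv m n), u ≤ act θ u
  act_le_act : ∀ (θ : Fin m →₀ ℕ) (u v : Deriv m n), v ≤ u → act θ v ≤ act θ u

/-- The ring `k{y₁, …, yₙ}` of differential polynomials in `m` derivations: commutative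
polynomials over `k` in the variables `ΘY`. -/
abbrev DiffPoly (k : Type*) [Field k] (m n : ℕ) := MvPolynomial (Deriv m n) k

/-- Application of a derivation of `k` to the coefficients of a polynomial. -/
def coeffMap {k : Type*} [Field k] {m n : ℕ} (D : Derivation ℤ k k) (f : DiffPoly k m n) :
    DiffPoly k m n :=
  ∑ s ∈ f.support, monomial s (D (f.coeff s))

theorem coeff_coeffMap {k : Type*} [Field k] {m n : ℕ} (D : Derivation ℤ k k)
    (f : DiffPoly k m n) (s : Deriv m n →₀ ℕ) : (coeffMap D f).coeff s = D (f.coeff s) := by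
  classical
  unfold coeffMap
  rw [coeff_sum]
  simp only [coeff_monomial]
  rw [Finset.sum_ite_eq']
  split_ifs with h
  · rfl
  · rw [notMem_support_iff.mp h, map_zero]

theorem coeffMap_mul {k : Type*} [Field k] {m n : ℕ} (D : Derivation ℤ k k)
    (f g : DiffPoly k m n) : coeffMap D (f * g) = f * coeffMap D g + g * coeffMap D f := by
  classical
  rw [mul_comm g]
  ext s
  simp only [coeff_add, coeff_coeffMap, coeff_mul, map_sum, ← Finset.sum_add_distrib]
  refine Finset.sum_congr rfl fun x _ => ?_
  rw [Derivation.leibniz, smul_eq_mul, smul_eq_mul]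
  ring

/-- The derivation `δ_i` of `k{Y}` that extends the derivation `d i` of `k` and maps each
derivative `u` to `δ_i u`. -/
def delta {k : Type*} [Field k] {m n : ℕ} (d : Fin m → Derivation ℤ k k) (i : Fin m)
    (f : DiffPoly k m n) : DiffPoly k m n :=
  coeffMap (d i) f + mkDerivation k (fun u : Deriv m n => X (act (Finsupp.single i 1) u)) f

theorem delta_add {k : Type*} [Field k] {m n : ℕ} (d : Fin m → Derivation ℤ k k) (i : Fin m)
    (f g : DiffPoly k m n) : delta d i (f + g) = delta d i f + delta d i g := by
  have h : coeffMap (d i) (f + g) = coeffMap (d i) f + coeffMap (d i) g := by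
    ext s
    simp only [coeff_add, coeff_coeffMap, map_add]
  unfold delta
  rw [h, map_add]
  ring

theorem delta_mul {k : Type*} [Field k] {m n : ℕ} (d : Fin m → Derivation ℤ k k) (i : Fin m)
    (f g : DiffPoly k m n) : delta d i (f * g) = f * delta d i g + g * delta d i f := by
  unfold delta
  rw [coeffMap_mul, Derivation.leibniz, smul_eq_mul, smul_eq_mul]
  ring

theorem delta_C {k : Type*} [Field k] {m n : ℕ} (d : Fin m → Derivation ℤ k k) (i : Fin m)
    (a : k) : delta d i (C a : DiffPoly k m n) = C (d i a) := by
  classical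
  have h : coeffMap (d i) (C a : DiffPoly k m n) = C (d i a) := by
    ext s
    rw [coeff_coeffMap, coeff_C, coeff_C]
    split_ifs <;> simp
  unfold delta
  rw [h, ← algebraMap_eq, Derivation.map_algebraMap, add_zero]

theorem delta_X {k : Type*} [Field k] {m n : ℕ} (d : Fin m → Derivation ℤ k k) (i : Fin m)
    (u : Deriv m n) :
    delta d i (X u : DiffPoly k m n) = X (act (Finsupp.single i 1) u) := by
  classical
  have h : coeffMap (d i) (X u : DiffPoly k m n) = 0 := by
    ext s
    rw [coeff_coeffMap, coeff_X, coeff_zero]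
    split_ifs <;> simp
  unfold delta
  rw [h, mkDerivation_X, zero_add]

/-- An ideal of `k{Y}` is differential if it is closed under all the derivations. -/
def IsDifferentialIdeal {k : Type*} [Field k] {m n : ℕ} (d : Fin m → Derivation ℤ k k)
    (I : Ideal (DiffPoly k m n)) : Prop :=
  ∀ (i : Fin m), ∀ f ∈ I, delta d i f ∈ I

/-- The algebraic section `I ∩ k[V]`. -/
def algSection {k : Type*} [Field k] {m n : ℕ} (I : Ideal (DiffPoly k m n))
    (V : Set (Deriv m n)) : Set (DiffPoly k m n) :=
  {f | f ∈ I ∧ f ∈ supported k V}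

open Classical in
/-- The coefficient of `u ^ d` in `f`, viewed as a univariate polynomial in `u`, for
`d = deg_u f`.  For `u` the leader of `f` it is the initial of `f`. -/
def topCoeff {k : Type*} [Field k] {m n : ℕ} (f : DiffPoly k m n) (u : Deriv m n) :
    DiffPoly k m n :=
  ∑ s ∈ f.support with s u = f.degreeOf u, monomial (s.erase u) (f.coeff s)

section Ranked

variable {k : Type*} [Field k] {m n : ℕ} [LinearOrder (Deriv m n)]

/-- The leader of `f`: the highest derivative that appears in `f`.  It is `⊥` exactly when
`f` lies in `k`. -/
def leader (f : DiffPoly k m n) : WithBot (Deriv m n) := f.vars.max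

/-- The rank `u ^ d` of `f`, where `u` is the leader of `f` and `d = deg_u f`, encoded as the
pair `(u, d)`; ranks are compared lexicographically.  It is `⊥` exactly when `f` lies in `k`. -/
def rk (f : DiffPoly k m n) : WithBot (Deriv m n ×ₗ ℕ) :=
  (leader f).map fun u => toLex (u, f.degreeOf u)

/-- The set `ld A` of leaders of the elements of `A`. -/
def leaders (A : Set (DiffPoly k m n)) : Set (Deriv m n) := {u | ∃ f ∈ A, leader f = ↑u}

/-- `f` is partially reduced w.r.t. `g`: no proper derivative of the leader of `g` appears
in `f`. -/
def PartiallyReduced (f g : DiffPoly k m n) : Prop :=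
  ∀ u : Deriv m n, leader g = ↑u → ∀ v ∈ f.vars, ¬ IsProperDerivative v u

/-- `f` is algebraically reduced w.r.t. `g`: `deg_u f < deg_u g` for the leader `u` of `g`. -/
def AlgReduced (f g : DiffPoly k m n) : Prop :=
  ∀ u : Deriv m n, leader g = ↑u → f.degreeOf u < g.degreeOf u

/-- A subset of `k{Y} \ k` is autoreduced if each element is (partially and algebraically)
reduced w.r.t. all the others. -/
def Autoreduced (A : Set (DiffPoly k m n)) : Prop :=
  (∀ f ∈ A, leader f ≠ ⊥) ∧
    ∀ f ∈ A, ∀ g ∈ A, f ≠ g → PartiallyReduced f g ∧ AlgReduced f g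

/-- A subset of `k{Y} \ k` is algebraically autoreduced if each element is algebraically
reduced w.r.t. all the others. -/
def AlgAutoreduced (A : Set (DiffPoly k m n)) : Prop :=
  (∀ f ∈ A, leader f ≠ ⊥) ∧ ∀ f ∈ A, ∀ g ∈ A, f ≠ g → AlgReduced f g

/-- A subset of `k{Y} \ k` is weak d-triangular if its elements have distinct leaders and the
set of these leaders is autoreduced, i.e. no leader is a derivative of the leader of another
element. -/
def WeakDTriangular (A : Set (DiffPoly k m n)) : Prop :=
  (∀ f ∈ A, leader f ≠ ⊥) ∧
    ∀ f ∈ A, ∀ g ∈ A, f ≠ g → ∀ u v : Deriv m n, leader f = ↑u → leader g = ↑v →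
      ∀ θ : Fin m →₀ ℕ, u ≠ act θ v

/-- `A` has lower rank than `B`: some `f ∈ A` has a rank that is not the rank of an element of
`B`, while below it the sets `A` and `B` have the same ranks.

For finite sets `A = A₁, …, A_r` and `B = B₁, …, B_s`, listed by strictly increasing rank, this
says that either there is `j ≤ r, s` with `rk A_i = rk B_i` for `i < j` and `rk A_j < rk B_j`, or
`r > s` and `rk A_i = rk B_i` for all `i ≤ s`: the polynomial `f` is `A_j` in the first case and
`A_(s+1)` in the second.  The present form makes sense for infinite sets too; algebraically
autoreduced sets may be infinite. -/
def LowerRank (A B : Set (DiffPoly k m n)) : Prop :=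
  ∃ f ∈ A, rk f ∉ rk '' B ∧ ∀ ρ < rk f, (ρ ∈ rk '' A ↔ ρ ∈ rk '' B)

/-- A (differential) characteristic set of `X`: an autoreduced subset of `X` of the lowest
rank. -/
def IsCharSet (X A : Set (DiffPoly k m n)) : Prop :=
  A ⊆ X ∧ Autoreduced A ∧ ∀ B ⊆ X, Autoreduced B → ¬ LowerRank B A

/-- An algebraic characteristic set of `X`: an algebraically autoreduced subset of `X` of the
lowest rank. -/
def IsAlgCharSet (X A : Set (DiffPoly k m n)) : Prop :=
  A ⊆ X ∧ AlgAutoreduced A ∧ ∀ B ⊆ X, AlgAutoreduced B → ¬ LowerRank B A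

/-- `f` is monic: the coefficient of its leading monomial is `1`, for the lexicographic order of
monomials that is induced by the ranking (two distinct monomials are compared by their exponents
at the highest derivative at which these differ). -/
def Monic (f : DiffPoly k m n) : Prop :=
  ∃ s ∈ f.support, f.coeff s = 1 ∧
    ∀ t ∈ f.support, t ≠ s → ∃ v, t v < s v ∧ ∀ w, v < w → t w = s w

/-- The requirements of canonicity, relative to a set `N` of non-leaders: for each element of
`A`, the initial lies in `k[N]`, the polynomial is monic, and it has no factors in `k[N] \ k`. -/
def CanonicalOver (N : Set (Deriv m n)) (A : Set (DiffPoly k m n)) : Prop :=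
  ∀ f ∈ A,
    (∀ u : Deriv m n, leader f = ↑u → topCoeff f u ∈ supported k N) ∧
    Monic f ∧
    ∀ p ∈ supported k N, p ∣ f → leader p = ⊥

/-- `A` is the canonical characteristic set of `X`; the set of non-leaders is
`ΘY \ Θ(ld A)`. -/
def IsCanonicalCharSet (X A : Set (DiffPoly k m n)) : Prop :=
  IsCharSet X A ∧ CanonicalOver (derivsOf (leaders A))ᶜ A

/-- `A` is the canonical algebraic characteristic set of a subset `X` of `k[V]`; the set of
non-leaders is `V \ ld A`. -/
def IsCanonicalAlgCharSet (V : Set (Deriv m n)) (X A : Set (DiffPoly k m n)) : Prop :=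
  IsAlgCharSet X A ∧ CanonicalOver (V \ leaders A) A

/-- `T` is a weak d-triangular subset of `A` of the least rank. -/
def IsLeastWeakDTriangularSubset (A T : Set (DiffPoly k m n)) : Prop :=
  T ⊆ A ∧ WeakDTriangular T ∧ ∀ T' ⊆ A, WeakDTriangular T' → ¬ LowerRank T' T

end Ranked

end DiffAlg

end

/-! Everything is read off the domain `k{Y} / I`. Call `v ∈ V` an algebraic leader if its class is
algebraic over the classes of the smaller elements of `V`, and let `leadDegree` be the least degree
of such a relation. A polynomial of `I ∩ k[V]` whose degree in every algebraic leader is below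
`leadDegree` is zero (`AlgNormal.eq_zero`), so the remaining elements of `V` are algebraically
independent modulo `I`, and the algebraic leaders are algebraic over them.

Hence initials can be moved into `k[N]`, `N` the non-leaders (`exists_mul_sub_mem`), and tails can
be pseudo-reduced (`hasNormalForm_Iic`). Removing factors in `k[N]` and normalizing leaves one
canonical relation per algebraic leader. It is unique: cross-multiplying two of them by their
initials gives a normal element of `I`, which vanishes, and a primitive relation is coprime to its
initial (`IsCanonicalRel.dvd`). These relations form `D = canonicalSet I V`, whose rank no
algebraically autoreduced subset of `I ∩ k[V]` can beat.

For `C ⊆ D`, differentiate. In characteristic 0 the separant of an element of `C` is nonzero and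
reduced with respect to `C`, so it is not in `I`; thus every proper derivative of a leader of `C`
has degree 1 modulo `I` over `ΘY`. A minimal relation over `ΘY` can then fail to be reduced with
respect to `C` only because of its own leader. So all algebraic leaders lie in `Θ(ld C)`, and the
elements of `C` have minimal degree, over `ΘY` and hence over `V`
(`IsCanonicalCharSet.subset_canonicalSet`).

Finally, each leader of `D` is a derivative of a leader of `C`. A weak d-triangular subset of `D`
with the ranks of `C` below a given rank therefore cannot contain a new element there, so `C` is
least; it is the only least one because elements of `D` are determined by their leaders. -/

noncomputable section

namespace DiffAlg

open MvPolynomial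

/-! ### Degrees, top coefficients and variables of polynomials -/

section Basics

variable {k : Type*} [Field k] {m n : ℕ}

theorem mem_supported_iff {W : Set (Deriv m n)} {f : DiffPoly k m n} :
    f ∈ supported k W ↔ ∀ s ∈ f.support, ∀ i, s i ≠ 0 → i ∈ W := by
  rw [mem_supported]
  constructor
  · intro h s hs i hi
    exact h ((mem_vars_iff_mem_support i).2 ⟨s, hs, Finsupp.mem_support_iff.2 hi⟩)
  · intro h i hi
    obtain ⟨s, hs, his⟩ := (mem_vars_iff_mem_support i).1 hi
    exact h s hs i (Finsupp.mem_support_iff.1 his)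

theorem degreeOf_eq_zero_of_notMem_vars {f : DiffPoly k m n} {u : Deriv m n} (h : u ∉ f.vars) :
    f.degreeOf u = 0 := by
  classical
  rw [vars_def, Multiset.mem_toFinset] at h
  rw [degreeOf_def]
  exact Multiset.count_eq_zero.2 h

theorem degreeOf_eq_zero_of_supported {W : Set (Deriv m n)} {f : DiffPoly k m n}
    (hf : f ∈ supported k W) {u : Deriv m n} (h : u ∉ W) : f.degreeOf u = 0 :=
  degreeOf_eq_zero_of_notMem_vars fun hu => h (mem_supported.1 hf hu)

theorem mem_vars_iff_degreeOf {f : DiffPoly k m n} {u : Deriv m n} :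
    u ∈ f.vars ↔ f.degreeOf u ≠ 0 := by
  constructor
  · intro h h0
    obtain ⟨s, hs, hu⟩ := (mem_vars_iff_mem_support u).1 h
    have := monomial_le_degreeOf u hs
    exact Finsupp.mem_support_iff.1 hu (by omega)
  · intro h
    by_contra h0
    exact h (degreeOf_eq_zero_of_notMem_vars h0)

theorem coeff_topCoeff (f : DiffPoly k m n) (u : Deriv m n) (t : Deriv m n →₀ ℕ) :
    (topCoeff f u).coeff t =
      if t u = 0 then f.coeff (t + Finsupp.single u (f.degreeOf u)) else 0 := by
  classical
  unfold topCoeff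
  rw [coeff_sum]
  simp only [coeff_monomial]
  split_ifs with h
  · rw [Finset.sum_eq_single (t + Finsupp.single u (f.degreeOf u))]
    · rw [if_pos]
      ext i
      by_cases hi : i = u
      · subst hi; simp [h]
      · simp [hi, Finsupp.erase_ne]
    · intro s hs hne
      rw [if_neg]
      rintro rfl
      apply hne
      rw [← (Finset.mem_filter.1 hs).2, Finsupp.erase_add_single]
    · intro hs
      rw [if_pos]
      · by_contra h0
        apply hs
        rw [Finset.mem_filter]
        exact ⟨mem_support_iff.2 h0, by simp [h]⟩
      · ext i
        by_cases hi : i = u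
        · subst hi; simp [h]
        · simp [hi, Finsupp.erase_ne]
  · refine Finset.sum_eq_zero fun s _ => if_neg ?_
    rintro rfl
    simp at h

theorem degreeOf_topCoeff_le (f : DiffPoly k m n) (u l : Deriv m n) :
    (topCoeff f u).degreeOf l ≤ f.degreeOf l := by
  rw [degreeOf_le_iff]
  intro t ht
  rw [mem_support_iff, coeff_topCoeff] at ht
  split_ifs at ht with h
  · refine le_trans ?_ (monomial_le_degreeOf l (mem_support_iff.2 ht))
    simp
  · exact absurd rfl ht

theorem degreeOf_topCoeff_self (f : DiffPoly k m n) (u : Deriv m n) :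
    (topCoeff f u).degreeOf u = 0 := by
  rw [← Nat.le_zero, degreeOf_le_iff]
  intro t ht
  rw [mem_support_iff, coeff_topCoeff] at ht
  split_ifs at ht with h
  · exact h.le
  · exact absurd rfl ht

theorem vars_topCoeff_subset (f : DiffPoly k m n) (u : Deriv m n) :
    ∀ l ∈ (topCoeff f u).vars, l ∈ f.vars ∧ l ≠ u := by
  intro l hl
  rw [mem_vars_iff_degreeOf] at hl ⊢
  have h1 := degreeOf_topCoeff_le f u l
  refine ⟨by omega, ?_⟩
  rintro rfl
  exact hl (degreeOf_topCoeff_self f l)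

theorem topCoeff_ne_zero {f : DiffPoly k m n} (hf : f ≠ 0) (u : Deriv m n) :
    topCoeff f u ≠ 0 := by
  classical
  obtain ⟨s, hs, hsu⟩ : ∃ s ∈ f.support, s u = f.degreeOf u := by
    rw [degreeOf_eq_sup]
    obtain ⟨s, hs, h⟩ := Finset.exists_mem_eq_sup f.support (support_nonempty.2 hf) (fun s => s u)
    exact ⟨s, hs, h.symm⟩
  intro h
  have h1 : (topCoeff f u).coeff (s.erase u) = 0 := by rw [h, coeff_zero]
  rw [coeff_topCoeff, if_pos (by simp), ← hsu, Finsupp.erase_add_single] at h1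
  exact mem_support_iff.1 hs h1

/-- The part of `f` that is left when the terms of highest degree in `u` are removed. -/
def tail (f : DiffPoly k m n) (u : Deriv m n) : DiffPoly k m n :=
  f - topCoeff f u * X u ^ f.degreeOf u

theorem topCoeff_mul_add_tail (f : DiffPoly k m n) (u : Deriv m n) :
    topCoeff f u * X u ^ f.degreeOf u + tail f u = f := by
  unfold tail; ring

theorem coeff_mul_X_pow_of_degreeOf_eq_zero {g : DiffPoly k m n} {u : Deriv m n}
    (hg : g.degreeOf u = 0) (d : ℕ) (t : Deriv m n →₀ ℕ) :
    (g * X u ^ d).coeff t = if t u = d then g.coeff (t.erase u) else 0 := by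
  classical
  rw [X_pow_eq_monomial, coeff_mul_monomial', mul_one]
  have h0 : ∀ s : Deriv m n →₀ ℕ, s u ≠ 0 → g.coeff s = 0 := by
    intro s hs
    by_contra hc
    have := monomial_le_degreeOf u (mem_support_iff.2 hc)
    omega
  by_cases h : t u = d
  · rw [if_pos h, if_pos]
    · congr 1
      ext i
      by_cases hi : i = u
      · subst hi; simp [h]
      · simp [hi, Finsupp.erase_ne, Finsupp.single_eq_of_ne hi]
    · rw [Finsupp.single_le_iff]; exact h.ge
  · rw [if_neg h]
    split_ifs with h1
    · apply h0
      rw [Finsupp.single_le_iff] at h1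
      simp
      omega
    · rfl

theorem coeff_tail (f : DiffPoly k m n) (u : Deriv m n) (t : Deriv m n →₀ ℕ) :
    (tail f u).coeff t = if t u = f.degreeOf u then 0 else f.coeff t := by
  unfold tail
  rw [coeff_sub, coeff_mul_X_pow_of_degreeOf_eq_zero (degreeOf_topCoeff_self f u)]
  split_ifs with h
  · rw [coeff_topCoeff, if_pos (by simp), ← h, Finsupp.erase_add_single, sub_self]
  · rw [sub_zero]

theorem degreeOf_tail_le (f : DiffPoly k m n) (u l : Deriv m n) :
    (tail f u).degreeOf l ≤ f.degreeOf l := by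
  rw [degreeOf_le_iff]
  intro t ht
  rw [mem_support_iff, coeff_tail] at ht
  split_ifs at ht with h
  · exact absurd rfl ht
  · exact monomial_le_degreeOf l (mem_support_iff.2 ht)

theorem degreeOf_tail_lt {f : DiffPoly k m n} {u : Deriv m n} (hu : f.degreeOf u ≠ 0) :
    (tail f u).degreeOf u < f.degreeOf u := by
  rw [degreeOf_lt_iff (Nat.pos_of_ne_zero hu)]
  intro t ht
  rw [mem_support_iff, coeff_tail] at ht
  split_ifs at ht with h
  · exact absurd rfl ht
  · exact lt_of_le_of_ne (monomial_le_degreeOf u (mem_support_iff.2 ht)) h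

theorem tail_mem_supported {W : Set (Deriv m n)} {f : DiffPoly k m n}
    (hf : f ∈ supported k W) (u : Deriv m n) : tail f u ∈ supported k W := by
  refine mem_supported.2 fun l hl => mem_supported.1 hf ?_
  have := degreeOf_tail_le f u l
  rw [Finset.mem_coe, mem_vars_iff_degreeOf] at *
  omega

theorem degreeOf_top_add {g r : DiffPoly k m n} {u : Deriv m n} {d : ℕ} (hg0 : g ≠ 0)
    (hg : g.degreeOf u = 0) (hr : r.degreeOf u < d) : (g * X u ^ d + r).degreeOf u = d := by
  have h : (g * X u ^ d).degreeOf u = d := by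
    rw [degreeOf_mul_X_self_pow_eq_add_of_ne_zero _ _ hg0, hg, zero_add]
  rw [degreeOf_add_eq_of_degreeOf_lt (by rwa [h]), h]

theorem topCoeff_top_add {g r : DiffPoly k m n} {u : Deriv m n} {d : ℕ} (hg0 : g ≠ 0)
    (hg : g.degreeOf u = 0) (hr : r.degreeOf u < d) : topCoeff (g * X u ^ d + r) u = g := by
  ext t
  rw [coeff_topCoeff, degreeOf_top_add hg0 hg hr]
  split_ifs with h
  · rw [coeff_add, coeff_mul_X_pow_of_degreeOf_eq_zero hg, if_pos (by simp [h])]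
    have h1 : r.coeff (t + Finsupp.single u d) = 0 := by
      by_contra hc
      have := monomial_le_degreeOf u (mem_support_iff.2 hc)
      simp [h] at this
      omega
    rw [h1, add_zero]
    congr 1
    ext i
    by_cases hi : i = u
    · subst hi; simp [h]
    · simp [hi, Finsupp.erase_ne]
  · by_contra hc
    have := monomial_le_degreeOf u (mem_support_iff.2 (Ne.symm hc))
    omega

theorem topCoeff_mul_of_degreeOf_eq_zero {q f : DiffPoly k m n} {u : Deriv m n} (hq0 : q ≠ 0)
    (hq : q.degreeOf u = 0) (hf : f.degreeOf u ≠ 0) :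
    topCoeff (q * f) u = q * topCoeff f u := by
  have hf0 : f ≠ 0 := by rintro rfl; simp at hf
  conv_lhs => rw [← topCoeff_mul_add_tail f u, mul_add, ← mul_assoc]
  apply topCoeff_top_add
  · exact mul_ne_zero hq0 (topCoeff_ne_zero hf0 u)
  · have := degreeOf_mul_le u q (topCoeff f u)
    rw [hq, degreeOf_topCoeff_self] at this
    omega
  · have := degreeOf_mul_le u q (tail f u)
    have := degreeOf_tail_lt hf
    omega

theorem vars_subset_of_dvd {f g : DiffPoly k m n} (h : f ∣ g) (hg : g ≠ 0) : f.vars ⊆ g.vars := by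
  obtain ⟨q, rfl⟩ := h
  intro u hu
  rw [mem_vars_iff_degreeOf] at hu ⊢
  rw [degreeOf_mul_eq (left_ne_zero_of_mul hg) (right_ne_zero_of_mul hg)]
  omega

theorem mem_supported_of_dvd {W : Set (Deriv m n)} {f g : DiffPoly k m n} (h : f ∣ g) (hg : g ≠ 0)
    (hW : g ∈ supported k W) : f ∈ supported k W :=
  mem_supported.2 fun _ hu => mem_supported.1 hW (vars_subset_of_dvd h hg hu)

theorem eq_C_of_vars_eq_empty {f : DiffPoly k m n} (h : f.vars = ∅) : ∃ a, f = C a := by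
  have : f ∈ supported k (∅ : Set (Deriv m n)) := mem_supported.2 (by simp [h])
  rw [supported_empty, Algebra.mem_bot] at this
  obtain ⟨a, ha⟩ := this
  exact ⟨a, ha.symm⟩

theorem C_notMem {I : Ideal (DiffPoly k m n)} (hI : I ≠ ⊤) {a : k} (ha : a ≠ 0) :
    (C a : DiffPoly k m n) ∉ I := fun h =>
  hI (Ideal.eq_top_of_isUnit_mem I h ((isUnit_iff_ne_zero.2 ha).map C))

theorem monomial_eq_erase_mul (s : Deriv m n →₀ ℕ) (c : k) (v : Deriv m n) :
    (monomial s c : DiffPoly k m n) = monomial (s.erase v) c * X v ^ s v := by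
  rw [X_pow_eq_monomial, monomial_mul, mul_one, Finsupp.erase_add_single]

theorem monomial_mem_supported {W : Set (Deriv m n)} {s : Deriv m n →₀ ℕ} {c : k}
    (h : ∀ i, s i ≠ 0 → i ∈ W) : (monomial s c : DiffPoly k m n) ∈ supported k W := by
  classical
  rw [mem_supported_iff]
  intro t ht
  have := support_monomial_subset ht
  rw [Finset.mem_singleton] at this
  rwa [this]

end Basics

/-! ### Leaders and ranks -/

section Leader

variable {k : Type*} [Field k] {m n : ℕ} [LinearOrder (Deriv m n)]

theorem leader_eq_bot_iff {f : DiffPoly k m n} : leader f = ⊥ ↔ f.vars = ∅ :=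
  Finset.max_eq_bot

theorem leader_eq_coe_iff {f : DiffPoly k m n} {u : Deriv m n} :
    leader f = ↑u ↔ u ∈ f.vars ∧ ∀ v ∈ f.vars, v ≤ u := by
  unfold leader
  constructor
  · intro h
    exact ⟨Finset.mem_of_max h, fun v hv => Finset.le_max_of_eq hv h⟩
  · rintro ⟨h1, h2⟩
    apply le_antisymm
    · exact Finset.max_le fun v hv => WithBot.coe_le_coe.2 (h2 v hv)
    · exact Finset.le_max h1

theorem exists_leader {f : DiffPoly k m n} (h : leader f ≠ ⊥) : ∃ u : Deriv m n, leader f = ↑u :=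
  ⟨_, (WithBot.coe_unbot _ h).symm⟩

theorem rk_eq_coe {f : DiffPoly k m n} {u : Deriv m n} (h : leader f = ↑u) :
    rk f = ↑(toLex (u, f.degreeOf u)) := by
  unfold rk; rw [h]; rfl

theorem leader_eq_of_rk_eq {f g : DiffPoly k m n} (h : rk f = rk g) {u : Deriv m n}
    (hf : leader f = ↑u) : leader g = ↑u ∧ g.degreeOf u = f.degreeOf u := by
  rw [rk_eq_coe hf] at h
  rcases eq_or_ne (leader g) ⊥ with hg | hg
  · unfold rk at h
    rw [hg] at h
    exact absurd h (by simp)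
  · obtain ⟨v, hv⟩ := exists_leader hg
    rw [rk_eq_coe hv] at h
    have h1 := WithBot.coe_injective h
    have h2 : (u, f.degreeOf u) = (v, g.degreeOf v) := toLex.injective h1
    simp only [Prod.mk.injEq] at h2
    obtain ⟨rfl, h3⟩ := h2
    exact ⟨hv, h3.symm⟩

theorem rk_lt_rk_iff {f g : DiffPoly k m n} {u v : Deriv m n} (hf : leader f = ↑u)
    (hg : leader g = ↑v) :
    rk f < rk g ↔ u < v ∨ u = v ∧ f.degreeOf u < g.degreeOf v := by
  rw [rk_eq_coe hf, rk_eq_coe hg, WithBot.coe_lt_coe, Prod.Lex.toLex_lt_toLex]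

theorem degreeOf_leader_ne_zero {f : DiffPoly k m n} {u : Deriv m n} (hf : leader f = ↑u) :
    f.degreeOf u ≠ 0 :=
  mem_vars_iff_degreeOf.1 (leader_eq_coe_iff.1 hf).1

theorem degreeOf_eq_zero_of_leader_lt {f : DiffPoly k m n} {u v : Deriv m n} (hf : leader f = ↑u)
    (h : u < v) : f.degreeOf v = 0 :=
  degreeOf_eq_zero_of_notMem_vars fun hv => absurd ((leader_eq_coe_iff.1 hf).2 v hv) (not_le.2 h)

theorem topCoeff_leader_mem_supported {V : Set (Deriv m n)} {f : DiffPoly k m n} {u : Deriv m n}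
    (hf : f ∈ supported k V) (hu : leader f = ↑u) :
    topCoeff f u ∈ supported k (V ∩ Set.Iio u) := by
  refine mem_supported.2 fun l hl => ?_
  obtain ⟨h1, h2⟩ := vars_topCoeff_subset f u l hl
  exact ⟨mem_supported.1 hf h1, lt_of_le_of_ne ((leader_eq_coe_iff.1 hu).2 l h1) h2⟩

theorem mem_supported_inter_Iic {V : Set (Deriv m n)} {f : DiffPoly k m n} {u : Deriv m n}
    (hf : f ∈ supported k V) (hu : leader f = ↑u) :
    f ∈ supported k (V ∩ Set.Iic u) :=
  mem_supported.2 fun l hl => ⟨mem_supported.1 hf hl, (leader_eq_coe_iff.1 hu).2 l hl⟩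

theorem leader_top_add {V : Set (Deriv m n)} {g r : DiffPoly k m n} {u : Deriv m n} {d : ℕ}
    (hg0 : g ≠ 0) (hg : g ∈ supported k (V ∩ Set.Iio u)) (hr : r ∈ supported k (V ∩ Set.Iic u))
    (hrd : r.degreeOf u < d) : leader (g * X u ^ d + r) = ↑u := by
  have hgu : g.degreeOf u = 0 := degreeOf_eq_zero_of_supported hg (by simp)
  rw [leader_eq_coe_iff]
  refine ⟨?_, ?_⟩
  · rw [mem_vars_iff_degreeOf, degreeOf_top_add hg0 hgu hrd]
    omega
  · have h : g * X u ^ d + r ∈ supported k (Set.Iic u) := by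
      refine add_mem (mul_mem (supported_mono (fun x hx => ?_) hg)
        (pow_mem (X_mem_supported.2 (by simp)) d)) (supported_mono (fun x hx => ?_) hr)
      · exact (le_of_lt hx.2 : x ≤ u)
      · exact hx.2
    exact fun v hv => mem_supported.1 h hv

end Leader

/-! ### Algebraic leaders modulo the ideal -/

section Relations

variable {k : Type*} [Field k] {m n : ℕ} [LinearOrder (Deriv m n)]

/-- A relation `g v ^ d + r ∈ I` of leader `v` with coefficients in `k[V]`, whose initial `g` does
not vanish modulo `I`. -/
structure LeadRel (I : Ideal (DiffPoly k m n)) (V : Set (Deriv m n)) (v : Deriv m n) (d : ℕ)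
    (g r : DiffPoly k m n) : Prop where
  mem_var : v ∈ V
  init_mem : g ∈ supported k (V ∩ Set.Iio v)
  init_notMem : g ∉ I
  tail_mem : r ∈ supported k (V ∩ Set.Iic v)
  tail_deg : r.degreeOf v < d
  mem : g * X v ^ d + r ∈ I

/-- The elements of `V` that are algebraic modulo `I` over the smaller elements of `V`. -/
def algLeaders (I : Ideal (DiffPoly k m n)) (V : Set (Deriv m n)) : Set (Deriv m n) :=
  {v | ∃ d g r, LeadRel I V v d g r}

/-- The degree of `v` modulo `I` over the smaller elements of `V`. -/
def leadDegree (I : Ideal (DiffPoly k m n)) (V : Set (Deriv m n)) (v : Deriv m n) : ℕ :=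
  sInf {d | ∃ g r, LeadRel I V v d g r}

/-- The degree of `f` in each leader `l` is less than the degree of `l` modulo `I`. -/
def AlgNormal (I : Ideal (DiffPoly k m n)) (V : Set (Deriv m n)) (f : DiffPoly k m n) : Prop :=
  ∀ l ∈ algLeaders I V, f.degreeOf l < leadDegree I V l

variable {I : Ideal (DiffPoly k m n)} {V : Set (Deriv m n)}

theorem LeadRel.init_ne_zero {v : Deriv m n} {d : ℕ} {g r : DiffPoly k m n}
    (h : LeadRel I V v d g r) : g ≠ 0 := by
  rintro rfl; exact h.init_notMem I.zero_mem

theorem LeadRel.mono {V' : Set (Deriv m n)} (hV : V ⊆ V') {v : Deriv m n} {d : ℕ}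
    {g r : DiffPoly k m n} (h : LeadRel I V v d g r) : LeadRel I V' v d g r :=
  ⟨hV h.mem_var, supported_mono (Set.inter_subset_inter_left _ hV) h.init_mem, h.init_notMem,
    supported_mono (Set.inter_subset_inter_left _ hV) h.tail_mem, h.tail_deg, h.mem⟩

theorem LeadRel.leadDegree_le {v : Deriv m n} {d : ℕ} {g r : DiffPoly k m n}
    (h : LeadRel I V v d g r) : leadDegree I V v ≤ d :=
  Nat.sInf_le ⟨g, r, h⟩

theorem exists_leadRel_leadDegree {v : Deriv m n} (hv : v ∈ algLeaders I V) :
    ∃ g r, LeadRel I V v (leadDegree I V v) g r :=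
  Nat.sInf_mem (s := {d | ∃ g r, LeadRel I V v d g r}) hv

theorem leadDegree_pos {v : Deriv m n} (hv : v ∈ algLeaders I V) : 0 < leadDegree I V v := by
  obtain ⟨g, r, h⟩ := exists_leadRel_leadDegree hv
  exact lt_of_le_of_lt (Nat.zero_le _) h.tail_deg

theorem algLeaders_mono {V' : Set (Deriv m n)} (hV : V ⊆ V') :
    algLeaders I V ⊆ algLeaders I V' := fun _ ⟨d, g, r, h⟩ => ⟨d, g, r, h.mono hV⟩

theorem leadDegree_anti {V' : Set (Deriv m n)} (hV : V ⊆ V') {v : Deriv m n}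
    (hv : v ∈ algLeaders I V) : leadDegree I V' v ≤ leadDegree I V v := by
  obtain ⟨g, r, h⟩ := exists_leadRel_leadDegree hv
  exact (h.mono hV).leadDegree_le

theorem LeadRel.of_leader {f : DiffPoly k m n} (hfI : f ∈ I) (hfV : f ∈ supported k V)
    {v : Deriv m n} (hv : leader f = ↑v) (ht : topCoeff f v ∉ I) :
    LeadRel I V v (f.degreeOf v) (topCoeff f v) (tail f v) where
  mem_var := mem_supported.1 hfV (leader_eq_coe_iff.1 hv).1
  init_mem := topCoeff_leader_mem_supported hfV hv
  init_notMem := ht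
  tail_mem := tail_mem_supported (mem_supported_inter_Iic hfV hv) v
  tail_deg := degreeOf_tail_lt (degreeOf_leader_ne_zero hv)
  mem := by rwa [topCoeff_mul_add_tail]

theorem AlgNormal.of_degreeOf_le {f g : DiffPoly k m n} (hg : AlgNormal I V g)
    (h : ∀ l, f.degreeOf l ≤ g.degreeOf l) : AlgNormal I V f :=
  fun l hl => (h l).trans_lt (hg l hl)

theorem AlgNormal.add {f g : DiffPoly k m n} (hf : AlgNormal I V f) (hg : AlgNormal I V g) :
    AlgNormal I V (f + g) :=
  fun l hl => (degreeOf_add_le l f g).trans_lt (max_lt (hf l hl) (hg l hl))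

theorem AlgNormal.mul_left {W : Set (Deriv m n)} {p f : DiffPoly k m n}
    (hp : p ∈ supported k (W \ algLeaders I V)) (hf : AlgNormal I V f) :
    AlgNormal I V (p * f) := fun l hl => by
  have h1 := degreeOf_mul_le l p f
  rw [degreeOf_eq_zero_of_supported hp (by simp [hl]), zero_add] at h1
  exact h1.trans_lt (hf l hl)

theorem algNormal_of_mem_supported {W : Set (Deriv m n)} {p : DiffPoly k m n}
    (hp : p ∈ supported k (W \ algLeaders I V)) : AlgNormal I V p := fun l hl => by
  rw [degreeOf_eq_zero_of_supported hp (by simp [hl])]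
  exact leadDegree_pos hl

/-- No nonzero element of `I ∩ k[V]` is reduced with respect to all the leaders. -/
theorem AlgNormal.eq_zero (hI : I ≠ ⊤) {f : DiffPoly k m n} (hf : AlgNormal I V f) (hfI : f ∈ I)
    (hfV : f ∈ supported k V) : f = 0 := by
  induction h : f.vars.card using Nat.strong_induction_on generalizing f with
  | _ N ih =>
    by_contra hf0
    rcases eq_or_ne (leader f) ⊥ with hb | hb
    · obtain ⟨a, rfl⟩ := eq_C_of_vars_eq_empty (leader_eq_bot_iff.1 hb)
      refine C_notMem hI (a := a) ?_ hfI
      rintro rfl; simp at hf0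
    · obtain ⟨v, hv⟩ := exists_leader hb
      -- An initial lying in `I` is still normal and has fewer variables, so the induction kills it.
      -- Otherwise `f` is itself a relation for `v`, of degree too small to exist.
      by_cases ht : topCoeff f v ∈ I
      · refine topCoeff_ne_zero hf0 v (ih _ ?_ (hf.of_degreeOf_le (degreeOf_topCoeff_le f v)) ht
          (supported_mono Set.inter_subset_left (topCoeff_leader_mem_supported hfV hv)) rfl)
        rw [← h]
        apply Finset.card_lt_card
        refine ⟨fun l hl => (vars_topCoeff_subset f v l hl).1, fun hs => ?_⟩
        exact (vars_topCoeff_subset f v v (hs (leader_eq_coe_iff.1 hv).1)).2 rfl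
      · have hr := LeadRel.of_leader hfI hfV hv ht
        have := hf v ⟨_, _, _, hr⟩
        have := hr.leadDegree_le
        omega

/-- Algebraic independence of the non-leaders modulo `I`: such a polynomial has degree 0 in every
algebraic leader, hence is normal. -/
theorem notMem_of_supported_nonleaders (hI : I ≠ ⊤) {W : Set (Deriv m n)} (hW : W ⊆ V)
    {p : DiffPoly k m n} (hp : p ∈ supported k (W \ algLeaders I V)) (hp0 : p ≠ 0) : p ∉ I :=
  fun h => hp0 ((algNormal_of_mem_supported hp).eq_zero hI h
    (supported_mono (Set.sdiff_subset.trans hW) hp))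

end Relations

/-! ### Inverting elements modulo the ideal, up to a denominator -/

section Inversion

variable {k : Type*} [Field k] {m n : ℕ}

/-- The subalgebra of `k{Y} / I` generated by the classes of the elements of `W`. -/
def quotAdjoin (I : Ideal (DiffPoly k m n)) (W : Set (Deriv m n)) :
    Subalgebra k (DiffPoly k m n ⧸ I) :=
  Algebra.adjoin k ((fun u => Ideal.Quotient.mkₐ k I (X u)) '' W)

variable {I : Ideal (DiffPoly k m n)}

theorem mem_quotAdjoin_iff {W : Set (Deriv m n)} {a : DiffPoly k m n ⧸ I} :
    a ∈ quotAdjoin I W ↔ ∃ g ∈ supported k W, Ideal.Quotient.mkₐ k I g = a := by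
  have h : quotAdjoin I W = (supported k W).map (Ideal.Quotient.mkₐ k I) := by
    unfold quotAdjoin
    rw [supported_eq_adjoin_X, AlgHom.map_adjoin, Set.image_image]
  rw [h, Subalgebra.mem_map]

theorem isAlgebraic_quotAdjoin_trans [I.IsPrime] {W W' : Set (Deriv m n)}
    (h : ∀ u ∈ W, IsAlgebraic (quotAdjoin I W') (Ideal.Quotient.mkₐ k I (X u)))
    {a : DiffPoly k m n ⧸ I} (ha : IsAlgebraic (quotAdjoin I W) a) :
    IsAlgebraic (quotAdjoin I W') a := by
  refine IsAlgebraic.adjoin_of_forall_isAlgebraic ?_ ha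
  rintro _ ⟨⟨u, hu, rfl⟩, -⟩
  exact h u hu

theorem isAlgebraic_of_mem_quotAdjoin [I.IsPrime] {W : Set (Deriv m n)} {a : DiffPoly k m n ⧸ I}
    (ha : a ∈ quotAdjoin I W) : IsAlgebraic (quotAdjoin I W) a :=
  isAlgebraic_algebraMap (A := DiffPoly k m n ⧸ I) (⟨a, ha⟩ : quotAdjoin I W)

/-- In a domain, a nonzero element algebraic over a subring divides a nonzero element of that
subring. This is what turns an initial into a polynomial in fewer variables. -/
theorem exists_mul_sub_mem [I.IsPrime] {W W' : Set (Deriv m n)} (hW : W' ⊆ W)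
    (h : ∀ u ∈ W, IsAlgebraic (quotAdjoin I W') (Ideal.Quotient.mkₐ k I (X u)))
    {g : DiffPoly k m n} (hg : g ∈ supported k W) (hgI : g ∉ I) :
    ∃ q ∈ supported k W, ∃ p ∈ supported k W', p ∉ I ∧ g * q - p ∈ I := by
  set φ := Ideal.Quotient.mkₐ k I with hφ
  have hker : ∀ f, φ f = 0 ↔ f ∈ I := fun f => Ideal.Quotient.eq_zero_iff_mem
  have halg : IsAlgebraic (quotAdjoin I W') (φ g) :=
    isAlgebraic_quotAdjoin_trans h
      (isAlgebraic_of_mem_quotAdjoin (mem_quotAdjoin_iff.2 ⟨g, hg, rfl⟩))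
  -- Working inside the ring generated by the class of `g` keeps the cofactor there, so that it has
  -- a representative in `k[W]`.
  let T := Algebra.adjoin (quotAdjoin I W') {φ g}
  let t : T := ⟨φ g, Algebra.subset_adjoin rfl⟩
  have ht : IsAlgebraic (quotAdjoin I W') t :=
    (isAlgebraic_algHom_iff T.val Subtype.val_injective).1 halg
  have ht0 : t ≠ 0 := by
    intro h0
    have := congrArg Subtype.val h0
    exact hgI ((hker g).1 this)
  obtain ⟨r, hr0, s, hs⟩ := ht.exists_nonzero_dvd (mem_nonZeroDivisors_of_ne_zero ht0)
  have hT : ∀ a ∈ T, a ∈ quotAdjoin I W := by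
    intro a ha
    refine Algebra.adjoin_induction (p := fun a _ => a ∈ quotAdjoin I W) ?_ ?_ ?_ ?_ ha
    · rintro _ rfl; exact mem_quotAdjoin_iff.2 ⟨g, hg, rfl⟩
    · intro b
      obtain ⟨f, hf, hfb⟩ := mem_quotAdjoin_iff.1 b.2
      exact mem_quotAdjoin_iff.2 ⟨f, supported_mono hW hf, hfb⟩
    · intro x y _ _ hx hy; exact add_mem hx hy
    · intro x y _ _ hx hy; exact mul_mem hx hy
  obtain ⟨q, hq, hqs⟩ := mem_quotAdjoin_iff.1 (hT _ s.2)
  obtain ⟨p, hp, hpr⟩ := mem_quotAdjoin_iff.1 r.2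
  refine ⟨q, hq, p, hp, ?_, ?_⟩
  · intro hpI
    apply hr0
    apply Subtype.ext
    rw [← hpr]
    exact (hker p).2 hpI
  · rw [← hker, map_sub, map_mul, sub_eq_zero]
    have := congrArg Subtype.val hs
    rw [hqs, hpr]
    exact this.symm

end Inversion

/-! ### Algebraicity over the non-leaders -/

section Algebraicity

variable {k : Type*} [Field k] {m n : ℕ} [LinearOrder (Deriv m n)]
variable {I : Ideal (DiffPoly k m n)} {V : Set (Deriv m n)}

theorem monomial_erase_mem_supported {f : DiffPoly k m n} {v : Deriv m n}
    (hf : f ∈ supported k (V ∩ Set.Iic v)) {s : Deriv m n →₀ ℕ} (hs : s ∈ f.support) (c : k) :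
    (monomial (s.erase v) c : DiffPoly k m n) ∈ supported k (V ∩ Set.Iio v) := by
  apply monomial_mem_supported
  intro i hi
  have hiv : i ≠ v := by rintro rfl; simp at hi
  rw [Finsupp.erase_ne hiv] at hi
  obtain ⟨h1, h2⟩ := mem_supported_iff.1 hf s hs i hi
  exact ⟨h1, lt_of_le_of_ne h2 hiv⟩

theorem LeadRel.isAlgebraic [I.IsPrime] {v : Deriv m n} {d : ℕ} {g r : DiffPoly k m n}
    (h : LeadRel I V v d g r) :
    IsAlgebraic (quotAdjoin I (V ∩ Set.Iio v)) (Ideal.Quotient.mkₐ k I (X v)) := by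
  classical
  set φ := Ideal.Quotient.mkₐ k I with hφ
  set R := quotAdjoin I (V ∩ Set.Iio v) with hR
  -- The default 0 never matters: `lift` is evaluated only at polynomials of `k[V ∩ Iio v]`.
  let lift : DiffPoly k m n → R := fun f => if hf : φ f ∈ R then ⟨φ f, hf⟩ else 0
  have hlift : ∀ f ∈ supported k (V ∩ Set.Iio v), ((lift f : R) : DiffPoly k m n ⧸ I) = φ f := by
    intro f hf
    have h1 : φ f ∈ R := mem_quotAdjoin_iff.2 ⟨f, hf, rfl⟩
    simp only [lift, dif_pos h1]
  let P : Polynomial R := Polynomial.C (lift g) * Polynomial.X ^ d +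
    ∑ s ∈ r.support, Polynomial.C (lift (monomial (s.erase v) (r.coeff s))) * Polynomial.X ^ s v
  refine ⟨P, ?_, ?_⟩
  · intro hP
    have h1 : P.coeff d = lift g := by
      simp only [P, Polynomial.coeff_add, Polynomial.coeff_C_mul_X_pow, if_true,
        Polynomial.finsetSum_coeff]
      rw [Finset.sum_eq_zero, add_zero]
      intro s hs
      rw [if_neg]
      have := monomial_le_degreeOf v hs
      have := h.tail_deg
      omega
    rw [hP, Polynomial.coeff_zero] at h1
    have h2 := hlift g h.init_mem
    rw [← h1] at h2
    exact h.init_notMem (Ideal.Quotient.eq_zero_iff_mem.1 h2.symm)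
  · have h0 : φ (g * X v ^ d + r) = 0 := Ideal.Quotient.eq_zero_iff_mem.2 h.mem
    rw [← h0]
    have h3 : ∀ x : R, algebraMap R (DiffPoly k m n ⧸ I) x = x := fun _ => rfl
    simp only [P, map_add, map_mul, map_pow, Polynomial.aeval_C, Polynomial.aeval_X, h3, map_sum]
    rw [hlift g h.init_mem]
    congr 1
    conv_rhs => rw [r.as_sum, map_sum]
    refine Finset.sum_congr rfl fun s hs => ?_
    rw [hlift _ (monomial_erase_mem_supported h.tail_mem hs _), monomial_eq_erase_mul s _ v,
      map_mul, map_pow]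

/-- Transitivity of algebraicity, along the well-founded ranking: a leader is algebraic over smaller
elements, which are algebraic over non-leaders by induction. -/
theorem isAlgebraic_over_nonleaders [WellFoundedLT (Deriv m n)] [I.IsPrime] (v : Deriv m n)
    (hv : v ∈ V) : IsAlgebraic (quotAdjoin I ((V ∩ Set.Iic v) \ algLeaders I V))
      (Ideal.Quotient.mkₐ k I (X v)) := by
  induction v using WellFoundedLT.induction with
  | _ v ih =>
    by_cases hL : v ∈ algLeaders I V
    · obtain ⟨d, g, r, h⟩ := hL
      refine isAlgebraic_quotAdjoin_trans (fun u hu => ?_) h.isAlgebraic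
      refine isAlgebraic_quotAdjoin_trans (fun w hw => ?_) (ih u hu.2 hu.1)
      refine isAlgebraic_of_mem_quotAdjoin (mem_quotAdjoin_iff.2 ⟨X w, X_mem_supported.2 ?_, rfl⟩)
      exact ⟨⟨hw.1.1, hw.1.2.trans hu.2.le⟩, hw.2⟩
    · exact isAlgebraic_of_mem_quotAdjoin
        (mem_quotAdjoin_iff.2 ⟨X v, X_mem_supported.2 ⟨⟨hv, le_rfl⟩, hL⟩, rfl⟩)

/-- Multiply a minimal relation by a `q` free of `v` that carries its initial into the non-leaders
modulo `I`; the degree in `v` is not affected. -/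
theorem exists_leadRel_init_nonleaders [WellFoundedLT (Deriv m n)] [I.IsPrime] {v : Deriv m n}
    (hv : v ∈ algLeaders I V) : ∃ p r, p ∈ supported k ((V ∩ Set.Iio v) \ algLeaders I V) ∧
      LeadRel I V v (leadDegree I V v) p r := by
  obtain ⟨g, r, h⟩ := exists_leadRel_leadDegree hv
  have halg : ∀ u ∈ V ∩ Set.Iio v,
      IsAlgebraic (quotAdjoin I ((V ∩ Set.Iio v) \ algLeaders I V))
        (Ideal.Quotient.mkₐ k I (X u)) := by
    intro u hu
    refine isAlgebraic_quotAdjoin_trans (fun w hw => ?_) (isAlgebraic_over_nonleaders u hu.1)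
    refine isAlgebraic_of_mem_quotAdjoin (mem_quotAdjoin_iff.2 ⟨X w, X_mem_supported.2 ?_, rfl⟩)
    exact ⟨⟨hw.1.1, lt_of_le_of_lt hw.1.2 hu.2⟩, hw.2⟩
  obtain ⟨q, hq, p, hp, hpI, hgq⟩ :=
    exists_mul_sub_mem Set.sdiff_subset halg h.init_mem h.init_notMem
  have hle : V ∩ Set.Iio v ⊆ V ∩ Set.Iic v := fun x hx => ⟨hx.1, hx.2.le⟩
  refine ⟨p, q * r, hp, h.mem_var, supported_mono Set.sdiff_subset hp, hpI,
    mul_mem (supported_mono hle hq) h.tail_mem, ?_, ?_⟩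
  · have h1 := degreeOf_mul_le v q r
    rw [degreeOf_eq_zero_of_supported hq (by simp), zero_add] at h1
    exact h1.trans_lt h.tail_deg
  · have : p * X v ^ leadDegree I V v + q * r =
        q * (g * X v ^ leadDegree I V v + r) - X v ^ leadDegree I V v * (g * q - p) := by ring
    rw [this]
    exact sub_mem (I.mul_mem_left _ h.mem) (I.mul_mem_left _ hgq)

end Algebraicity

/-! ### Normal forms by pseudo-reduction -/

section Reduction

variable {k : Type*} [Field k] {m n : ℕ} [LinearOrder (Deriv m n)]
variable {I : Ideal (DiffPoly k m n)} {V W : Set (Deriv m n)}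

/-- A multiple of `g` by a nonzero polynomial in non-leaders is congruent modulo `I` to a
polynomial that is reduced with respect to all the leaders. -/
def HasNormalForm (I : Ideal (DiffPoly k m n)) (V W : Set (Deriv m n)) (g : DiffPoly k m n) :
    Prop :=
  ∃ q ∈ supported k (W \ algLeaders I V), q ≠ 0 ∧
    ∃ r ∈ supported k W, AlgNormal I V r ∧ q * g - r ∈ I

theorem HasNormalForm.mono {W' : Set (Deriv m n)} (hW : W ⊆ W') {g : DiffPoly k m n}
    (h : HasNormalForm I V W g) : HasNormalForm I V W' g := by
  obtain ⟨q, hq, hq0, r, hr, hn, hI⟩ := h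
  exact ⟨q, supported_mono (Set.sdiff_subset_sdiff_left hW) hq, hq0, r, supported_mono hW hr, hn,
    hI⟩

theorem HasNormalForm.of_algNormal {g : DiffPoly k m n} (hg : g ∈ supported k W)
    (hn : AlgNormal I V g) : HasNormalForm I V W g :=
  ⟨1, one_mem _, one_ne_zero, g, hg, hn, by simp⟩

theorem HasNormalForm.add {f g : DiffPoly k m n} (hf : HasNormalForm I V W f)
    (hg : HasNormalForm I V W g) : HasNormalForm I V W (f + g) := by
  obtain ⟨p, hp, hp0, r, hr, hrn, hrI⟩ := hf
  obtain ⟨q, hq, hq0, s, hs, hsn, hsI⟩ := hg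
  refine ⟨p * q, mul_mem hp hq, mul_ne_zero hp0 hq0, q * r + p * s,
    add_mem (mul_mem (supported_mono Set.sdiff_subset hq) hr)
      (mul_mem (supported_mono Set.sdiff_subset hp) hs),
    (hrn.mul_left hq).add (hsn.mul_left hp), ?_⟩
  have : p * q * (f + g) - (q * r + p * s) = q * (p * f - r) + p * (q * g - s) := by ring
  rw [this]
  exact add_mem (I.mul_mem_left _ hrI) (I.mul_mem_left _ hsI)

theorem HasNormalForm.neg {f : DiffPoly k m n} (hf : HasNormalForm I V W f) :
    HasNormalForm I V W (-f) := by
  obtain ⟨p, hp, hp0, r, hr, hrn, hrI⟩ := hf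
  refine ⟨p, hp, hp0, -r, neg_mem hr, fun l hl => by rw [degreeOf_neg]; exact hrn l hl, ?_⟩
  have : p * -f - -r = -(p * f - r) := by ring
  rw [this]
  exact neg_mem hrI

theorem HasNormalForm.zero : HasNormalForm I V W (0 : DiffPoly k m n) :=
  .of_algNormal (zero_mem _) fun l hl => by simpa using leadDegree_pos hl

theorem HasNormalForm.sum {ι : Type*} (S : Finset ι) (f : ι → DiffPoly k m n)
    (h : ∀ i ∈ S, HasNormalForm I V W (f i)) : HasNormalForm I V W (∑ i ∈ S, f i) := by
  classical
  induction S using Finset.induction_on with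
  | empty => simpa using HasNormalForm.zero
  | insert a S ha ih =>
    rw [Finset.sum_insert ha]
    exact (h a (Finset.mem_insert_self _ _)).add
      (ih fun i hi => h i (Finset.mem_insert_of_mem hi))

theorem HasNormalForm.of_mul {p f : DiffPoly k m n} (hp : p ∈ supported k (W \ algLeaders I V))
    (hp0 : p ≠ 0) (h : HasNormalForm I V W (p * f)) : HasNormalForm I V W f := by
  obtain ⟨q, hq, hq0, r, hr, hrn, hrI⟩ := h
  exact ⟨q * p, mul_mem hq hp, mul_ne_zero hq0 hp0, r, hr, hrn, by rwa [mul_assoc]⟩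

theorem HasNormalForm.congr {f g : DiffPoly k m n} (h : HasNormalForm I V W f)
    (hfg : f - g ∈ I) : HasNormalForm I V W g := by
  obtain ⟨q, hq, hq0, r, hr, hrn, hrI⟩ := h
  refine ⟨q, hq, hq0, r, hr, hrn, ?_⟩
  have : q * g - r = (q * f - r) - q * (f - g) := by ring
  rw [this]
  exact sub_mem hrI (I.mul_mem_left _ hfg)

theorem HasNormalForm.mul_X_pow {v : Deriv m n} (hv : v ∈ V) {g : DiffPoly k m n}
    (hg : HasNormalForm I V (V ∩ Set.Iio v) g) {j : ℕ}
    (hj : v ∈ algLeaders I V → j < leadDegree I V v) :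
    HasNormalForm I V (V ∩ Set.Iic v) (g * X v ^ j) := by
  obtain ⟨q, hq, hq0, r, hr, hrn, hrI⟩ := hg
  have hle : V ∩ Set.Iio v ⊆ V ∩ Set.Iic v := fun x hx => ⟨hx.1, hx.2.le⟩
  refine ⟨q, supported_mono (Set.sdiff_subset_sdiff_left hle) hq, hq0, r * X v ^ j,
    mul_mem (supported_mono hle hr) (pow_mem (X_mem_supported.2 (show v ∈ V ∩ Set.Iic v from
      ⟨hv, le_rfl⟩)) j), ?_, ?_⟩
  · intro l hl
    by_cases hlv : l = v
    · subst hlv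
      have h1 := degreeOf_mul_le l r (X l ^ j)
      rw [degreeOf_eq_zero_of_supported hr (by simp), degreeOf_X_self_pow, zero_add] at h1
      exact h1.trans_lt (hj hl)
    · rw [degreeOf_mul_X_pow_of_ne _ hlv]
      exact hrn l hl
  · have : q * (g * X v ^ j) - r * X v ^ j = X v ^ j * (q * g - r) := by ring
    rw [this]
    exact I.mul_mem_left _ hrI

/-- Pseudo-division by a minimal relation `p v ^ d + r`: when `j ≥ d`, multiply by `p` and trade `p
v ^ d` for `-r`, whose terms have degree below `d` in `v`. The multiplier `p` is harmless because it
involves non-leaders only. -/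
theorem hasNormalForm_mul_X_pow [WellFoundedLT (Deriv m n)] [I.IsPrime] {v : Deriv m n}
    (hv : v ∈ V)
    (h : ∀ g ∈ supported k (V ∩ Set.Iio v), HasNormalForm I V (V ∩ Set.Iio v) g) (j : ℕ) :
    ∀ g ∈ supported k (V ∩ Set.Iio v), HasNormalForm I V (V ∩ Set.Iic v) (g * X v ^ j) := by
  induction j using Nat.strong_induction_on with
  | _ j ih =>
    intro g hg
    by_cases hj : v ∈ algLeaders I V → j < leadDegree I V v
    · exact (h g hg).mul_X_pow hv hj
    · push Not at hj
      obtain ⟨hL, hdj⟩ := hj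
      obtain ⟨p, r, hp, hrel⟩ := exists_leadRel_init_nonleaders hL
      have hle : V ∩ Set.Iio v ⊆ V ∩ Set.Iic v := fun x hx => ⟨hx.1, hx.2.le⟩
      refine HasNormalForm.of_mul (supported_mono (Set.sdiff_subset_sdiff_left hle) hp)
        hrel.init_ne_zero ?_
      set d := leadDegree I V v with hd
      have hlow : HasNormalForm I V (V ∩ Set.Iic v) (-(r * g * X v ^ (j - d))) := by
        refine HasNormalForm.neg ?_
        conv => arg 4; rw [r.as_sum, Finset.sum_mul, Finset.sum_mul]
        refine HasNormalForm.sum _ _ fun s hs => ?_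
        have h1 : monomial s (r.coeff s) * g * X v ^ (j - d) =
            (monomial (s.erase v) (r.coeff s) * g) * X v ^ (s v + (j - d)) := by
          rw [monomial_eq_erase_mul s _ v, pow_add]; ring
        rw [h1]
        apply ih
        · have := monomial_le_degreeOf v hs
          have := hrel.tail_deg
          omega
        · exact mul_mem (monomial_erase_mem_supported hrel.tail_mem hs _) hg
      refine hlow.congr ?_
      have h2 : (X v : DiffPoly k m n) ^ j = X v ^ d * X v ^ (j - d) := by
        rw [← pow_add]; congr 1; omega
      have : -(r * g * X v ^ (j - d)) - p * (g * X v ^ j) =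
          -(g * X v ^ (j - d)) * (p * X v ^ d + r) := by rw [h2]; ring
      rw [this]
      exact I.mul_mem_left _ hrel.mem

theorem hasNormalForm_Iic_of_Iio [WellFoundedLT (Deriv m n)] [I.IsPrime] {v : Deriv m n}
    (hv : v ∈ V)
    (h : ∀ g ∈ supported k (V ∩ Set.Iio v), HasNormalForm I V (V ∩ Set.Iio v) g)
    {f : DiffPoly k m n} (hf : f ∈ supported k (V ∩ Set.Iic v)) :
    HasNormalForm I V (V ∩ Set.Iic v) f := by
  rw [f.as_sum]
  refine HasNormalForm.sum _ _ fun s hs => ?_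
  rw [monomial_eq_erase_mul s _ v]
  exact hasNormalForm_mul_X_pow hv h _ _ (monomial_erase_mem_supported hf hs _)

theorem hasNormalForm_Iio [WellFoundedLT (Deriv m n)] [I.IsPrime] (v : Deriv m n) :
    ∀ f ∈ supported k (V ∩ Set.Iio v), HasNormalForm I V (V ∩ Set.Iio v) f := by
  induction v using WellFoundedLT.induction with
  | _ v ih =>
    intro f hf
    rcases eq_or_ne (leader f) ⊥ with hb | hb
    · refine HasNormalForm.of_algNormal hf fun l hl => ?_
      rw [degreeOf_eq_zero_of_notMem_vars (by simp [leader_eq_bot_iff.1 hb])]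
      exact leadDegree_pos hl
    · obtain ⟨u, hu⟩ := exists_leader hb
      have huV := mem_supported.1 hf (leader_eq_coe_iff.1 hu).1
      refine (hasNormalForm_Iic_of_Iio huV.1 (ih u huV.2) (f := f) ?_).mono
        (fun x hx => And.intro hx.1 (lt_of_le_of_lt hx.2 huV.2))
      exact mem_supported.2 fun l hl =>
        ⟨(mem_supported.1 hf hl).1, (leader_eq_coe_iff.1 hu).2 l hl⟩

theorem hasNormalForm_Iic [WellFoundedLT (Deriv m n)] [I.IsPrime] {v : Deriv m n} (hv : v ∈ V)
    {f : DiffPoly k m n} (hf : f ∈ supported k (V ∩ Set.Iic v)) :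
    HasNormalForm I V (V ∩ Set.Iic v) f :=
  hasNormalForm_Iic_of_Iio hv (hasNormalForm_Iio v) hf

end Reduction

/-! ### Canonical relations: existence and uniqueness -/

section Canonical

variable {k : Type*} [Field k] {m n : ℕ} [LinearOrder (Deriv m n)]
variable {I : Ideal (DiffPoly k m n)} {V : Set (Deriv m n)}

/-- `f` is an element of `I ∩ k[V]` of leader `v` and minimal degree in `v`, it is reduced with
respect to the other leaders, and its initial is a polynomial in the non-leaders. -/
structure IsMinimalRel (I : Ideal (DiffPoly k m n)) (V : Set (Deriv m n)) (v : Deriv m n)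
    (f : DiffPoly k m n) : Prop where
  mem : f ∈ I
  mem_supp : f ∈ supported k V
  leader_eq : leader f = ↑v
  degreeOf_eq : f.degreeOf v = leadDegree I V v
  reduced : ∀ l ∈ algLeaders I V, l ≠ v → f.degreeOf l < leadDegree I V l
  init_mem : topCoeff f v ∈ supported k (V \ algLeaders I V)

/-- `f` is the canonical element of `I ∩ k[V]` of leader `v`. -/
structure IsCanonicalRel (I : Ideal (DiffPoly k m n)) (V : Set (Deriv m n)) (v : Deriv m n)
    (f : DiffPoly k m n) : Prop extends IsMinimalRel I V v f where
  monic : Monic f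
  primitive : ∀ p ∈ supported k (V \ algLeaders I V), p ∣ f → leader p = ⊥

theorem IsMinimalRel.ne_zero {v : Deriv m n} {f : DiffPoly k m n} (h : IsMinimalRel I V v f) :
    f ≠ 0 := by
  rintro rfl
  have := degreeOf_leader_ne_zero h.leader_eq
  simp at this

/-- Replace the tail of a minimal relation with non-leader initial by its normal form. -/
theorem exists_isMinimalRel [WellFoundedLT (Deriv m n)] (hI : I.IsPrime) {v : Deriv m n}
    (hv : v ∈ algLeaders I V) : ∃ f, IsMinimalRel I V v f := by
  obtain ⟨p, r, hp, h⟩ := exists_leadRel_init_nonleaders hv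
  obtain ⟨q, hq, hq0, s, hs, hsn, hsI⟩ :=
    hasNormalForm_Iic (I := I) h.mem_var h.tail_mem
  -- The multiplier avoids `v` itself, since `v` is an algebraic leader, so `q * p` can serve as the
  -- new initial.
  have hqv : q ∈ supported k ((V ∩ Set.Iio v) \ algLeaders I V) := by
    refine mem_supported.2 fun x hx => ?_
    obtain ⟨⟨h1, h2⟩, h3⟩ := mem_supported.1 hq hx
    exact ⟨⟨h1, lt_of_le_of_ne h2 fun h => h3 (h ▸ hv)⟩, h3⟩
  have hqp := mul_mem hqv hp
  have hqp0 : q * p ≠ 0 := mul_ne_zero hq0 h.init_ne_zero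
  have hqp1 := supported_mono (R := k) (Set.sdiff_subset) hqp
  have hdeg : (q * p).degreeOf v = 0 := degreeOf_eq_zero_of_supported hqp1 (by simp)
  refine ⟨q * p * X v ^ leadDegree I V v + s, ?_, ?_, ?_, ?_, ?_, ?_⟩
  · have : q * p * X v ^ leadDegree I V v + s =
        q * (p * X v ^ leadDegree I V v + r) - (q * r - s) := by ring
    rw [this]
    exact sub_mem (I.mul_mem_left _ h.mem) hsI
  · exact add_mem (mul_mem (supported_mono Set.inter_subset_left hqp1)
      (pow_mem (X_mem_supported.2 h.mem_var) _)) (supported_mono Set.inter_subset_left hs)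
  · exact leader_top_add hqp0 hqp1 hs (hsn v hv)
  · exact degreeOf_top_add hqp0 hdeg (hsn v hv)
  · intro l hl hlv
    refine (degreeOf_add_le _ _ _).trans_lt (max_lt ?_ (hsn l hl))
    rw [degreeOf_mul_X_pow_of_ne _ hlv, degreeOf_eq_zero_of_supported hqp (by simp [hl])]
    exact leadDegree_pos hl
  · rw [topCoeff_top_add hqp0 hdeg (hsn v hv)]
    exact supported_mono (Set.sdiff_subset_sdiff_left Set.inter_subset_left) hqp

/-- The factor `q` is outside the prime ideal `I` and does not involve algebraic leaders, so
cancelling it changes no relevant degree. -/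
theorem IsMinimalRel.of_mul (hI : I.IsPrime) {v : Deriv m n} (hv : v ∈ algLeaders I V)
    {q f : DiffPoly k m n} (hq : q ∈ supported k (V \ algLeaders I V))
    (h : IsMinimalRel I V v (q * f)) : IsMinimalRel I V v f := by
  have hqf := h.ne_zero
  have hq0 := left_ne_zero_of_mul hqf
  have hf0 := right_ne_zero_of_mul hqf
  have hdeg : ∀ l, (q * f).degreeOf l = q.degreeOf l + f.degreeOf l :=
    fun l => degreeOf_mul_eq hq0 hf0
  have hqv : q.degreeOf v = 0 := degreeOf_eq_zero_of_supported hq (by simp [hv])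
  have hdf : f.degreeOf v = (q * f).degreeOf v := by rw [hdeg, hqv, zero_add]
  have hne : f.degreeOf v ≠ 0 := by rw [hdf]; exact degreeOf_leader_ne_zero h.leader_eq
  refine ⟨?_, mem_supported_of_dvd (dvd_mul_left f q) hqf h.mem_supp, ?_, ?_, ?_, ?_⟩
  · exact (hI.mem_or_mem h.mem).resolve_left
      (notMem_of_supported_nonleaders hI.ne_top subset_rfl hq hq0)
  · rw [leader_eq_coe_iff]
    exact ⟨mem_vars_iff_degreeOf.2 hne, fun u hu =>
      (leader_eq_coe_iff.1 h.leader_eq).2 u (vars_subset_of_dvd (dvd_mul_left f q) hqf hu)⟩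
  · rw [hdf, h.degreeOf_eq]
  · intro l hl hlv
    have := h.reduced l hl hlv
    rw [hdeg] at this
    omega
  · have h1 := h.init_mem
    rw [topCoeff_mul_of_degreeOf_eq_zero hq0 hqv hne] at h1
    exact mem_supported_of_dvd (dvd_mul_left _ _) (mul_ne_zero hq0 (topCoeff_ne_zero hf0 v)) h1

theorem exists_isMinimalRel_primitive [WellFoundedLT (Deriv m n)] (hI : I.IsPrime)
    {v : Deriv m n} (hv : v ∈ algLeaders I V) : ∃ f, IsMinimalRel I V v f ∧
      ∀ p ∈ supported k (V \ algLeaders I V), p ∣ f → leader p = ⊥ := by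
  have hex : ∃ N : ℕ, ∃ f, IsMinimalRel I V v f ∧ f.totalDegree = N := by
    obtain ⟨f, hf⟩ := exists_isMinimalRel (V := V) hI hv
    exact ⟨_, f, hf, rfl⟩
  classical
  -- A minimal relation of least total degree is primitive: the cofactor of a factor in the
  -- non-leaders is again a minimal relation.
  obtain ⟨f, hf, hfN⟩ := Nat.find_spec hex
  refine ⟨f, hf, ?_⟩
  rintro p hp ⟨g, rfl⟩
  have hg := hf.of_mul hI hv hp
  have h0 := hf.ne_zero
  have h1 := totalDegree_mul_of_isDomain (left_ne_zero_of_mul h0) (right_ne_zero_of_mul h0)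
  have h2 := Nat.find_min' hex ⟨g, hg, rfl⟩
  rw [← hfN, h1] at h2
  have h3 : p.totalDegree = 0 := by omega
  rw [leader_eq_bot_iff]
  rw [Finset.eq_empty_iff_forall_notMem]
  intro u hu
  rw [mem_vars_iff_degreeOf] at hu
  have := degreeOf_le_totalDegree p u
  omega

/-- The monomial order that defines `Monic`. -/
def MonomialLT (t s : Deriv m n →₀ ℕ) : Prop := ∃ v, t v < s v ∧ ∀ w, v < w → t w = s w

theorem MonomialLT.asymm {s t : Deriv m n →₀ ℕ} (h : MonomialLT s t) : ¬ MonomialLT t s := by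
  rintro ⟨v, hv, hv'⟩
  obtain ⟨w, hw, hw'⟩ := h
  rcases lt_trichotomy v w with h1 | rfl | h1
  · have := hv' w h1; omega
  · omega
  · have := hw' v h1; omega

theorem exists_leadingMonomial {f : DiffPoly k m n} (hf : f ≠ 0) :
    ∃ s ∈ f.support, ∀ t ∈ f.support, t ≠ s → MonomialLT t s := by
  -- `Finsupp.Lex` decides at the smallest differing index, `Monic` at the highest; hence the dual
  -- order.
  let e : (Deriv m n →₀ ℕ) → Lex ((Deriv m n)ᵒᵈ →₀ ℕ) := fun s => toLex s
  obtain ⟨s, hs, hmax⟩ := Finset.exists_max_image f.support e (support_nonempty.2 hf)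
  refine ⟨s, hs, fun t ht hts => ?_⟩
  have hlt : e t < e s := lt_of_le_of_ne (hmax t ht) fun h => hts (toLex.injective h)
  rw [Finsupp.Lex.lt_iff] at hlt
  obtain ⟨v, hv, hv'⟩ := hlt
  exact ⟨v, hv', fun w hw => hv w hw⟩

theorem Monic.eq_of_C_mul {f : DiffPoly k m n} {a : k} (ha : a ≠ 0) (hf : Monic f)
    (haf : Monic (C a * f)) : C a * f = f := by
  obtain ⟨s, hs, hs1, hsm⟩ := hf
  obtain ⟨t, ht, ht1, htm⟩ := haf
  have hsupp : ∀ x, x ∈ (C a * f).support ↔ x ∈ f.support := by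
    intro x
    rw [mem_support_iff, mem_support_iff, coeff_C_mul, mul_ne_zero_iff]
    exact ⟨fun h => h.2, fun h => ⟨ha, h⟩⟩
  have hst : s = t := by
    by_contra hne
    exact MonomialLT.asymm (hsm t ((hsupp t).1 ht) (Ne.symm hne)) (htm s ((hsupp s).2 hs) hne)
  subst hst
  rw [coeff_C_mul, hs1, mul_one] at ht1
  rw [ht1, C_1, one_mul]

theorem exists_C_mul_monic {f : DiffPoly k m n} (hf : f ≠ 0) :
    ∃ a : k, a ≠ 0 ∧ Monic (C a * f) := by
  obtain ⟨s, hs, hm⟩ := exists_leadingMonomial hf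
  have hc := mem_support_iff.1 hs
  refine ⟨(f.coeff s)⁻¹, inv_ne_zero hc, s, ?_, ?_, fun t ht hts => hm t ?_ hts⟩
  · rw [mem_support_iff, coeff_C_mul]
    exact mul_ne_zero (inv_ne_zero hc) hc
  · rw [coeff_C_mul, inv_mul_cancel₀ hc]
  · rw [mem_support_iff, coeff_C_mul] at ht
    exact mem_support_iff.2 (right_ne_zero_of_mul ht)

theorem exists_isCanonicalRel [WellFoundedLT (Deriv m n)] (hI : I.IsPrime)
    {v : Deriv m n} (hv : v ∈ algLeaders I V) : ∃ f, IsCanonicalRel I V v f := by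
  obtain ⟨f, hf, hp⟩ := exists_isMinimalRel_primitive (V := V) hI hv
  obtain ⟨a, ha, hm⟩ := exists_C_mul_monic hf.ne_zero
  have hC : ∀ b : k, (C b : DiffPoly k m n) ∈ supported k (V \ algLeaders I V) :=
    fun b => (supported k _).algebraMap_mem b
  have heq : f = C a⁻¹ * (C a * f) := by
    rw [← mul_assoc, ← C_mul, inv_mul_cancel₀ ha, C_1, one_mul]
  refine ⟨C a * f, ⟨IsMinimalRel.of_mul hI hv (hC a⁻¹) (by rwa [← heq]), hm, fun p hpN hpf => ?_⟩⟩
  exact hp p hpN (by rw [heq]; exact hpf.mul_left _)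

/-- The difference of the two sides lies in `I` and is normal: the top powers of `v` cancel, and the
initials add no degree in the other leaders. -/
theorem IsMinimalRel.mul_topCoeff_comm (hI : I.IsPrime) {v : Deriv m n}
    (hv : v ∈ algLeaders I V) {f g : DiffPoly k m n} (hf : IsMinimalRel I V v f)
    (hg : IsMinimalRel I V v g) : topCoeff g v * f = topCoeff f v * g := by
  rw [← sub_eq_zero]
  have hN : ∀ {p : DiffPoly k m n}, p ∈ supported k (V \ algLeaders I V) →
      ∀ l ∈ algLeaders I V, p.degreeOf l = 0 :=
    fun hp l hl => degreeOf_eq_zero_of_supported hp (by simp [hl])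
  refine AlgNormal.eq_zero (V := V) hI.ne_top ?_
    (sub_mem (I.mul_mem_left _ hf.mem) (I.mul_mem_left _ hg.mem))
    (sub_mem (mul_mem (supported_mono Set.sdiff_subset hg.init_mem) hf.mem_supp)
      (mul_mem (supported_mono Set.sdiff_subset hf.init_mem) hg.mem_supp))
  intro l hl
  by_cases hlv : l = v
  · subst hlv
    have h1 : topCoeff g l * f - topCoeff f l * g =
        topCoeff g l * tail f l - topCoeff f l * tail g l := by
      unfold tail
      rw [hf.degreeOf_eq, hg.degreeOf_eq]
      ring
    rw [h1]
    refine (degreeOf_sub_le _ _ _).trans_lt (max_lt ?_ ?_)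
    · refine (degreeOf_mul_le _ _ _).trans_lt ?_
      rw [hN hg.init_mem l hl, zero_add, ← hf.degreeOf_eq]
      exact degreeOf_tail_lt (degreeOf_leader_ne_zero hf.leader_eq)
    · refine (degreeOf_mul_le _ _ _).trans_lt ?_
      rw [hN hf.init_mem l hl, zero_add, ← hg.degreeOf_eq]
      exact degreeOf_tail_lt (degreeOf_leader_ne_zero hg.leader_eq)
  · refine (degreeOf_sub_le _ _ _).trans_lt (max_lt ?_ ?_)
    · refine (degreeOf_mul_le _ _ _).trans_lt ?_
      rw [hN hg.init_mem l hl, zero_add]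
      exact hf.reduced l hl hlv
    · refine (degreeOf_mul_le _ _ _).trans_lt ?_
      rw [hN hf.init_mem l hl, zero_add]
      exact hg.reduced l hl hlv

/-- A common divisor of `f` and its initial involves non-leaders only, so primitivity makes it
constant. As `f` divides its initial times `g`, it divides `g`. -/
theorem IsCanonicalRel.dvd (hI : I.IsPrime) {v : Deriv m n} (hv : v ∈ algLeaders I V)
    {f g : DiffPoly k m n} (hf : IsCanonicalRel I V v f) (hg : IsCanonicalRel I V v g) :
    f ∣ g := by
  have h := hf.toIsMinimalRel.mul_topCoeff_comm hI hv hg.toIsMinimalRel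
  have hrel : IsRelPrime f (topCoeff f v) := by
    intro c hcf hct
    have ht0 := topCoeff_ne_zero hf.ne_zero v
    have hc0 : c ≠ 0 := ne_zero_of_dvd_ne_zero ht0 hct
    have hb := hf.primitive c (mem_supported_of_dvd hct ht0 hf.init_mem) hcf
    obtain ⟨a, rfl⟩ := eq_C_of_vars_eq_empty (leader_eq_bot_iff.1 hb)
    refine (isUnit_iff_ne_zero.2 ?_).map C
    rintro rfl; simp at hc0
  exact hrel.dvd_of_dvd_mul_left ⟨topCoeff g v, by rw [← h, mul_comm]⟩

theorem IsCanonicalRel.unique (hI : I.IsPrime) {v : Deriv m n} (hv : v ∈ algLeaders I V)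
    {f g : DiffPoly k m n} (hf : IsCanonicalRel I V v f) (hg : IsCanonicalRel I V v g) :
    f = g := by
  obtain ⟨u, hu⟩ := associated_of_dvd_dvd (hf.dvd hI hv hg) (hg.dvd hI hv hf)
  obtain ⟨a, ha⟩ := eq_C_of_vars_eq_empty (f := (u : DiffPoly k m n)) <| by
    rw [Finset.eq_empty_iff_forall_notMem]
    intro y hy
    have h1 := vars_subset_of_dvd u.isUnit.dvd (one_ne_zero (α := DiffPoly k m n)) hy
    simp at h1
  have ha0 : a ≠ 0 := by
    rintro rfl
    exact u.ne_zero (by rw [ha, C_0])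
  rw [ha, mul_comm] at hu
  rw [← hu, hf.monic.eq_of_C_mul ha0 (by rw [hu]; exact hg.monic)]

end Canonical

/-! ### Rankings are well-orders -/

section Ranking

variable {m n : ℕ}

theorem act_zero (u : Deriv m n) : act 0 u = u := by
  ext1 <;> simp [act]

theorem act_add (θ θ' : Fin m →₀ ℕ) (u : Deriv m n) : act (θ + θ') u = act θ (act θ' u) := by
  ext1 <;> simp [act, add_assoc]

theorem act_injective (θ : Fin m →₀ ℕ) : Function.Injective (act θ : Deriv m n → Deriv m n) := by
  intro u v h
  have h1 := congrArg Deriv.op h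
  have h2 := congrArg Deriv.var h
  simp only [act] at h1 h2
  exact Deriv.ext (add_left_cancel h1) h2

theorem act_ne_self {θ : Fin m →₀ ℕ} (h : θ ≠ 0) (u : Deriv m n) : act θ u ≠ u := by
  intro h0
  have h1 := congrArg Deriv.op h0
  simp only [act] at h1
  exact h (by simpa using h1)

variable [LinearOrder (Deriv m n)]

theorem IsRanking.lt_act (h : IsRanking m n) {θ : Fin m →₀ ℕ} (hθ : θ ≠ 0) (u : Deriv m n) :
    u < act θ u :=
  lt_of_le_of_ne (h.le_act θ u) (act_ne_self hθ u).symm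

theorem IsRanking.act_lt_act (h : IsRanking m n) (θ : Fin m →₀ ℕ) {u v : Deriv m n} (huv : u < v) :
    act θ u < act θ v :=
  lt_of_le_of_ne (h.act_le_act θ v u huv.le) fun he => huv.ne (act_injective θ he)

/-- Dickson's lemma: in an infinite descending chain some term would be a derivative of an earlier
one, hence not below it. -/
theorem IsRanking.wellFoundedLT (h : IsRanking m n) : WellFoundedLT (Deriv m n) := by
  refine ⟨?_⟩
  rw [wellFounded_iff_isEmpty_descending_chain]
  refine ⟨fun ⟨f, hf⟩ => ?_⟩
  have hanti : StrictAnti f := strictAnti_nat_of_succ_lt hf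
  have hw : WellQuasiOrdered fun a b : (Fin m →₀ ℕ) × Fin n => a.1 ≤ b.1 ∧ a.2 = b.2 :=
    WellQuasiOrdered.prod wellQuasiOrdered_le (Finite.wellQuasiOrdered (· = ·))
  obtain ⟨i, j, hij, h1, h2⟩ := hw fun i => ((f i).op, (f i).var)
  have : f j = act ((f j).op - (f i).op) (f i) :=
    Deriv.ext (tsub_add_cancel_of_le h1).symm h2.symm
  have hle := h.le_act ((f j).op - (f i).op) (f i)
  rw [← this] at hle
  exact absurd (hanti hij) (not_lt.2 hle)

end Ranking

/-! ### The canonical algebraic characteristic set -/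

section CanonicalSet

variable {k : Type*} [Field k] {m n : ℕ} [LinearOrder (Deriv m n)]
variable {I : Ideal (DiffPoly k m n)} {V : Set (Deriv m n)}

/-- The least rank at which the two sets differ decides. This makes sets of incomparable rank have
the same ranks. -/
theorem lowerRank_or_lowerRank [WellFoundedLT (Deriv m n)] {A B : Set (DiffPoly k m n)}
    (h : rk '' A ≠ rk '' B) : LowerRank A B ∨ LowerRank B A := by
  let S := {ρ | ¬ (ρ ∈ rk '' A ↔ ρ ∈ rk '' B)}
  have hS : S.Nonempty := by
    by_contra hc
    apply h
    ext ρ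
    by_contra h1
    exact hc ⟨ρ, h1⟩
  have wf : WellFounded ((· < ·) : WithBot (Deriv m n ×ₗ ℕ) → _ → Prop) := wellFounded_lt
  have hmem := wf.min_mem S hS
  have hmin : ∀ ρ < wf.min S hS, (ρ ∈ rk '' A ↔ ρ ∈ rk '' B) := fun ρ hρ => by
    by_contra h1
    exact wf.not_lt_min S h1 hρ
  by_cases hA : wf.min S hS ∈ rk '' A
  · left
    have hB : wf.min S hS ∉ rk '' B := fun hB => hmem ⟨fun _ => hB, fun _ => hA⟩
    obtain ⟨f, hf, hfr⟩ := hA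
    rw [← hfr] at hB hmin
    exact ⟨f, hf, hB, hmin⟩
  · right
    have hB : wf.min S hS ∈ rk '' B := by
      by_contra hB
      exact hmem ⟨fun h => absurd h hA, fun h => absurd h hB⟩
    obtain ⟨f, hf, hfr⟩ := hB
    rw [← hfr] at hA hmin
    exact ⟨f, hf, hA, fun ρ hρ => (hmin ρ hρ).symm⟩

/-- The set of the canonical elements of `I ∩ k[V]`, one for each leader. -/
def canonicalSet (I : Ideal (DiffPoly k m n)) (V : Set (Deriv m n)) : Set (DiffPoly k m n) :=
  {f | ∃ v ∈ algLeaders I V, IsCanonicalRel I V v f}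

theorem isCanonicalRel_of_mem_canonicalSet {f : DiffPoly k m n} (hf : f ∈ canonicalSet I V)
    {v : Deriv m n} (hv : leader f = ↑v) : v ∈ algLeaders I V ∧ IsCanonicalRel I V v f := by
  obtain ⟨w, hw, h⟩ := hf
  have : w = v := by
    have := h.leader_eq
    rw [hv] at this
    exact (WithBot.coe_injective this).symm
  subst this
  exact ⟨hw, h⟩

theorem leader_ne_bot_of_mem_canonicalSet {f : DiffPoly k m n} (hf : f ∈ canonicalSet I V) :
    leader f ≠ ⊥ := by
  obtain ⟨w, hw, h⟩ := hf
  rw [h.leader_eq]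
  exact WithBot.coe_ne_bot

theorem eq_of_mem_canonicalSet (hI : I.IsPrime) {f g : DiffPoly k m n}
    (hf : f ∈ canonicalSet I V) (hg : g ∈ canonicalSet I V) (h : leader f = leader g) :
    f = g := by
  obtain ⟨v, hv, hfv⟩ := hf
  have hgv := isCanonicalRel_of_mem_canonicalSet hg (h ▸ hfv.leader_eq)
  exact hfv.unique hI hv hgv.2

theorem leaders_canonicalSet [WellFoundedLT (Deriv m n)] (hI : I.IsPrime) :
    leaders (canonicalSet I V) = algLeaders I V := by
  ext v
  constructor
  · rintro ⟨f, hf, hv⟩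
    exact (isCanonicalRel_of_mem_canonicalSet hf hv).1
  · intro hv
    obtain ⟨f, hf⟩ := exists_isCanonicalRel hI hv
    exact ⟨f, ⟨v, hv, hf⟩, hf.leader_eq⟩

theorem algAutoreduced_canonicalSet (hI : I.IsPrime) : AlgAutoreduced (canonicalSet I V) := by
  refine ⟨fun f hf => leader_ne_bot_of_mem_canonicalSet hf, fun f hf g hg hfg u hu => ?_⟩
  obtain ⟨hgL, hgu⟩ := isCanonicalRel_of_mem_canonicalSet hg hu
  rw [hgu.degreeOf_eq]
  obtain ⟨v, hv, hfv⟩ := hf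
  refine hfv.reduced u hgL fun huv => hfg ?_
  subst huv
  exact hfv.unique hI hv hgu

/-- The deciding element `f` of `B` would be a nonzero normal element of `I`. Compare it with the
canonical relation of each leader: if that has higher rank, the degree bound is immediate; if lower,
`B` has an element of the same rank, and `f` is reduced with respect to it. -/
theorem not_lowerRank_canonicalSet [WellFoundedLT (Deriv m n)] (hI : I.IsPrime)
    {B : Set (DiffPoly k m n)} (hB : B ⊆ algSection I V) (hBr : AlgAutoreduced B) :
    ¬ LowerRank B (canonicalSet I V) := by
  rintro ⟨f, hf, hfr, hlow⟩
  obtain ⟨v, hv⟩ := exists_leader (hBr.1 f hf)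
  have hnorm : AlgNormal I V f := by
    intro l hl
    obtain ⟨g, hg⟩ := exists_isCanonicalRel hI hl
    have hgD : g ∈ canonicalSet I V := ⟨l, hl, hg⟩
    rw [← hg.degreeOf_eq]
    rcases lt_trichotomy (rk f) (rk g) with h | h | h
    · rcases (rk_lt_rk_iff hv hg.leader_eq).1 h with h1 | ⟨rfl, h1⟩
      · rw [degreeOf_eq_zero_of_leader_lt hv h1]
        exact Nat.pos_of_ne_zero (degreeOf_leader_ne_zero hg.leader_eq)
      · exact h1
    · exact absurd ⟨g, hgD, h.symm⟩ hfr
    · obtain ⟨g', hg', hgr⟩ := (hlow _ h).2 ⟨g, hgD, rfl⟩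
      obtain ⟨h1, h2⟩ := leader_eq_of_rk_eq hgr.symm hg.leader_eq
      have hne : f ≠ g' := by
        rintro rfl
        rw [hgr] at h
        exact lt_irrefl _ h
      rw [← h2]
      exact hBr.2 f hf g' hg' hne l h1
  have hf0 := hnorm.eq_zero hI.ne_top (hB hf).1 (hB hf).2
  have := degreeOf_leader_ne_zero hv
  rw [hf0] at this
  simp at this

theorem canonicalSet_subset : canonicalSet I V ⊆ algSection I V := by
  rintro f ⟨v, _, h⟩
  exact ⟨h.mem, h.mem_supp⟩

theorem isCanonicalAlgCharSet_canonicalSet [WellFoundedLT (Deriv m n)] (hI : I.IsPrime) :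
    IsCanonicalAlgCharSet V (algSection I V) (canonicalSet I V) := by
  refine ⟨⟨canonicalSet_subset, algAutoreduced_canonicalSet hI,
    fun B hB hBr => not_lowerRank_canonicalSet hI hB hBr⟩, ?_⟩
  rw [leaders_canonicalSet hI]
  intro f hf
  refine ⟨fun u hu => (isCanonicalRel_of_mem_canonicalSet hf hu).2.init_mem, ?_⟩
  obtain ⟨v, _, h⟩ := hf
  exact ⟨h.monic, h.primitive⟩

theorem leaders_eq_of_image_rk_eq {A B : Set (DiffPoly k m n)} (h : rk '' A = rk '' B) :
    leaders A = leaders B := by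
  have key : ∀ {A B : Set (DiffPoly k m n)}, rk '' A = rk '' B → leaders A ⊆ leaders B := by
    rintro A B h u ⟨f, hf, hu⟩
    obtain ⟨g, hg, hgr⟩ : rk f ∈ rk '' B := h ▸ ⟨f, hf, rfl⟩
    exact ⟨g, hg, (leader_eq_of_rk_eq hgr.symm hu).1⟩
  exact (key h).antisymm (key h.symm)

/-- Neither set has lower rank, so ranks, leaders and the set of non-leaders agree. Being
autoreduced then bounds the degrees of the elements of `A` by `leadDegree`, which makes them
canonical relations. -/
theorem eq_canonicalSet [WellFoundedLT (Deriv m n)] (hI : I.IsPrime) {A : Set (DiffPoly k m n)}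
    (hA : IsCanonicalAlgCharSet V (algSection I V) A) : A = canonicalSet I V := by
  obtain ⟨⟨hAJ, hAr, hAl⟩, hAc⟩ := hA
  have hrk : rk '' A = rk '' canonicalSet I V := by
    by_contra hne
    rcases lowerRank_or_lowerRank hne with h | h
    · exact not_lowerRank_canonicalSet hI hAJ hAr h
    · exact hAl _ canonicalSet_subset (algAutoreduced_canonicalSet hI) h
  rw [leaders_eq_of_image_rk_eq hrk, leaders_canonicalSet hI] at hAc
  have hsub : A ⊆ canonicalSet I V := by
    intro f hf
    obtain ⟨g, hg, hgr⟩ : rk f ∈ rk '' canonicalSet I V := hrk ▸ ⟨f, hf, rfl⟩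
    obtain ⟨v, hv, hgv⟩ := hg
    obtain ⟨hfv, hfd⟩ := leader_eq_of_rk_eq hgr hgv.leader_eq
    obtain ⟨h1, h2, h3⟩ := hAc f hf
    refine ⟨v, hv, ⟨⟨(hAJ hf).1, (hAJ hf).2, hfv, hfd.trans hgv.degreeOf_eq, ?_, h1 v hfv⟩, h2, h3⟩⟩
    intro l hl hlv
    obtain ⟨e, he⟩ := exists_isCanonicalRel hI hl
    obtain ⟨e', he', her⟩ : rk e ∈ rk '' A := hrk ▸ ⟨e, ⟨l, hl, he⟩, rfl⟩
    obtain ⟨h4, h5⟩ := leader_eq_of_rk_eq her.symm he.leader_eq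
    have hne : f ≠ e' := by
      rintro rfl
      rw [hfv] at h4
      exact hlv (WithBot.coe_injective h4).symm
    rw [← he.degreeOf_eq, ← h5]
    exact hAr.2 f hf e' he' hne l h4
  refine hsub.antisymm fun f hf => ?_
  obtain ⟨g, hg, hgr⟩ : rk f ∈ rk '' A := hrk ▸ ⟨f, hf, rfl⟩
  obtain ⟨v, hv⟩ := exists_leader (leader_ne_bot_of_mem_canonicalSet hf)
  have := eq_of_mem_canonicalSet hI hf (hsub hg)
    (hv.trans (leader_eq_of_rk_eq hgr.symm hv).1.symm)
  rwa [this]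

end CanonicalSet

/-! ### Partial derivatives and separants -/

section PartialDerivatives

variable {k : Type*} [Field k] {m n : ℕ}

theorem add_single_mem_support_of_pderiv {f : DiffPoly k m n} {u : Deriv m n}
    {t : Deriv m n →₀ ℕ} (ht : t ∈ (pderiv u f).support) :
    t + Finsupp.single u 1 ∈ f.support := by
  rw [mem_support_iff, coeff_pderiv] at ht
  exact mem_support_iff.2 (left_ne_zero_of_mul ht)

theorem degreeOf_pderiv_le (f : DiffPoly k m n) (u l : Deriv m n) :
    (pderiv u f).degreeOf l ≤ f.degreeOf l := by
  rw [degreeOf_le_iff]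
  intro t ht
  have := monomial_le_degreeOf l (add_single_mem_support_of_pderiv ht)
  rw [Finsupp.add_apply] at this
  omega

theorem degreeOf_pderiv_lt {f : DiffPoly k m n} {u : Deriv m n} (hu : f.degreeOf u ≠ 0) :
    (pderiv u f).degreeOf u < f.degreeOf u := by
  rw [degreeOf_lt_iff (Nat.pos_of_ne_zero hu)]
  intro t ht
  have := monomial_le_degreeOf u (add_single_mem_support_of_pderiv ht)
  rw [Finsupp.add_apply, Finsupp.single_eq_same] at this
  omega

theorem vars_pderiv_subset (f : DiffPoly k m n) (u : Deriv m n) :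
    (pderiv u f).vars ⊆ f.vars := by
  intro l hl
  have := degreeOf_pderiv_le f u l
  rw [mem_vars_iff_degreeOf] at hl ⊢
  omega

theorem pderiv_ne_zero [CharZero k] {f : DiffPoly k m n} {u : Deriv m n}
    (hu : u ∈ f.vars) : pderiv u f ≠ 0 := by
  obtain ⟨s, hs, hsu⟩ := (mem_vars_iff_mem_support u).1 hu
  intro h
  have h1 : (pderiv u f).coeff (s - Finsupp.single u 1) = 0 := by rw [h, coeff_zero]
  rw [coeff_pderiv, Finsupp.sub_add_single_one_cancel (Finsupp.mem_support_iff.1 hsu)] at h1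
  rcases mul_eq_zero.1 h1 with h2 | h2
  · exact mem_support_iff.1 hs h2
  · exact Nat.cast_add_one_ne_zero _ h2

theorem vars_coeffMap_subset (D : Derivation ℤ k k) (f : DiffPoly k m n) :
    (coeffMap D f).vars ⊆ f.vars := by
  intro u hu
  obtain ⟨s, hs, hsu⟩ := (mem_vars_iff_mem_support u).1 hu
  refine (mem_vars_iff_mem_support u).2 ⟨s, ?_, hsu⟩
  rw [mem_support_iff, coeff_coeffMap] at hs
  rw [mem_support_iff]
  intro h
  rw [h, map_zero] at hs
  exact hs rfl

theorem mkDerivation_eq_sum_pderiv (h : Deriv m n → DiffPoly k m n) (f : DiffPoly k m n) :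
    mkDerivation k h f = ∑ y ∈ f.vars, pderiv y f * h y := by
  classical
  let E : Derivation k (DiffPoly k m n) (DiffPoly k m n) := ∑ y ∈ f.vars, h y • pderiv y
  have hE : ∀ g, E g = ∑ y ∈ f.vars, pderiv y g * h y := by
    intro g
    simp only [E]
    rw [← Derivation.coeFnAddMonoidHom_apply, map_sum, Finset.sum_apply]
    refine Finset.sum_congr rfl fun y _ => ?_
    rw [Derivation.coeFnAddMonoidHom_apply, Derivation.smul_apply, smul_eq_mul, mul_comm]
  rw [← hE]
  refine derivation_eq_of_forall_mem_vars fun i hi => ?_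
  rw [hE, mkDerivation_X, Finset.sum_eq_single i]
  · simp
  · intro y _ hy
    rw [pderiv_X_of_ne hy.symm, zero_mul]
  · intro h0; exact absurd hi h0

end PartialDerivatives

/-! ### Derivatives of a relation are linear in their leader -/

section Prolongation

variable {k : Type*} [Field k] {m n : ℕ} [LinearOrder (Deriv m n)]
variable {I : Ideal (DiffPoly k m n)}

/-- By the chain rule `δ_i u` enters linearly with the separant as coefficient; all else is lower
because `δ_i` is strictly increasing on derivatives. -/
theorem IsRanking.delta_eq (hr : IsRanking m n) (d : Fin m → Derivation ℤ k k) (i : Fin m)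
    {f : DiffPoly k m n} {u : Deriv m n} (hu : ∀ y ∈ f.vars, y ≤ u) :
    ∃ r ∈ supported k (Set.Iio (act (Finsupp.single i 1) u)),
      delta d i f = pderiv u f * X (act (Finsupp.single i 1) u) + r := by
  classical
  have hlt : u < act (Finsupp.single i 1) u := hr.lt_act (by simp) u
  have hsub : ∀ g : DiffPoly k m n, g.vars ⊆ f.vars →
      g ∈ supported k (Set.Iio (act (Finsupp.single i 1) u)) := fun g hg =>
    mem_supported.2 fun y hy => lt_of_le_of_lt (hu y (hg hy)) hlt
  refine ⟨coeffMap (d i) f + ∑ y ∈ f.vars.erase u, pderiv y f * X (act (Finsupp.single i 1) y),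
    add_mem (hsub _ (vars_coeffMap_subset _ _)) (sum_mem fun y hy => mul_mem
      (hsub _ (vars_pderiv_subset f y)) (X_mem_supported.2 ?_)), ?_⟩
  · obtain ⟨h1, h2⟩ := Finset.mem_erase.1 hy
    exact hr.act_lt_act _ (lt_of_le_of_ne (hu y h2) h1)
  · unfold delta
    rw [mkDerivation_eq_sum_pderiv]
    by_cases h : u ∈ f.vars
    · rw [← Finset.add_sum_erase _ _ h]; ring
    · rw [Finset.erase_eq_of_notMem h, pderiv_eq_zero_of_notMem_vars h]; ring

/-- `I` contains a polynomial in the derivatives up to `u` whose separant with respect to `u` does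
not lie in `I`. -/
def HasSeparable (I : Ideal (DiffPoly k m n)) (u : Deriv m n) : Prop :=
  ∃ f ∈ I, (∀ y ∈ f.vars, y ≤ u) ∧ pderiv u f ∉ I

/-- The separant of `δ_i f` at `δ_i u` is the separant of `f` at `u`, so separability survives
differentiation and the initial of the linear relation stays outside `I`. -/
theorem HasSeparable.act_single (hr : IsRanking m n) {d : Fin m → Derivation ℤ k k}
    (hI : IsDifferentialIdeal d I) (i : Fin m) {u : Deriv m n} (h : HasSeparable I u) :
    HasSeparable I (act (Finsupp.single i 1) u) ∧
      ∃ g r, LeadRel I Set.univ (act (Finsupp.single i 1) u) 1 g r := by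
  obtain ⟨f, hf, hfu, hs⟩ := h
  obtain ⟨r, hrs, hd⟩ := hr.delta_eq d i hfu
  have hlt : u < act (Finsupp.single i 1) u := hr.lt_act (by simp) u
  set w := act (Finsupp.single i 1) u with hw
  have hsep : pderiv u f ∈ supported k (Set.Iio w) := mem_supported.2 fun y hy =>
    lt_of_le_of_lt (hfu y (vars_pderiv_subset f u hy)) hlt
  have hle : ∀ {g : DiffPoly k m n}, g ∈ supported k (Set.Iio w) → g ∈ supported k (Set.Iic w) :=
    fun hg => supported_mono Set.Iio_subset_Iic_self hg
  have hnot : ∀ {g : DiffPoly k m n}, g ∈ supported k (Set.Iio w) → w ∉ g.vars :=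
    fun hg hy => lt_irrefl w (mem_supported.1 hg hy)
  have hmem := hI i f hf
  refine ⟨⟨delta d i f, hmem, ?_, ?_⟩, pderiv u f, r, ⟨Set.mem_univ _, ?_, hs, ?_, ?_, ?_⟩⟩
  · have : delta d i f ∈ supported k (Set.Iic w) := by
      rw [hd]
      exact add_mem (mul_mem (hle hsep) (X_mem_supported.2 (Set.mem_Iic.2 le_rfl))) (hle hrs)
    exact fun y hy => mem_supported.1 this hy
  · rw [hd, map_add, pderiv_mul, pderiv_eq_zero_of_notMem_vars (hnot hsep),
      pderiv_eq_zero_of_notMem_vars (hnot hrs), pderiv_X_self]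
    simpa using hs
  · rwa [Set.univ_inter]
  · rw [Set.univ_inter]; exact hle hrs
  · rw [degreeOf_eq_zero_of_notMem_vars (hnot hrs)]; exact one_pos
  · rw [pow_one, ← hd]; exact hmem

theorem HasSeparable.act (hr : IsRanking m n) {d : Fin m → Derivation ℤ k k}
    (hI : IsDifferentialIdeal d I) (θ : Fin m →₀ ℕ) {u : Deriv m n} (h : HasSeparable I u) :
    HasSeparable I (act θ u) := by
  induction θ using Finsupp.induction_linear generalizing u with
  | zero => rwa [act_zero]
  | add θ θ' h1 h2 => rw [act_add]; exact h1 (h2 h)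
  | single i a =>
    induction a with
    | zero => rwa [Finsupp.single_zero, act_zero]
    | succ a ih =>
      rw [add_comm, Finsupp.single_add, act_add]
      exact (ih.act_single hr hI i).1

theorem HasSeparable.exists_leadRel_one (hr : IsRanking m n) {d : Fin m → Derivation ℤ k k}
    (hI : IsDifferentialIdeal d I) {θ : Fin m →₀ ℕ} (hθ : θ ≠ 0) {u : Deriv m n}
    (h : HasSeparable I u) : ∃ g r, LeadRel I Set.univ (DiffAlg.act θ u) 1 g r := by
  obtain ⟨i, hi⟩ : ∃ i, θ i ≠ 0 := by
    by_contra hc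
    push Not at hc
    exact hθ (Finsupp.ext hc)
  have : θ = Finsupp.single i 1 + (θ - Finsupp.single i 1) := by
    rw [add_comm, Finsupp.sub_add_single_one_cancel hi]
  rw [this, act_add]
  exact ((h.act hr hI _).act_single hr hI i).2

end Prolongation

/-! ### Differential characteristic sets and comparison with the algebraic one -/

section CharSet

variable {k : Type*} [Field k] {m n : ℕ} [LinearOrder (Deriv m n)]
variable {I : Ideal (DiffPoly k m n)} {C : Set (DiffPoly k m n)}

/-- An ideal contains no nonzero polynomial that is reduced with respect to a characteristic
set of it. -/
theorem IsCharSet.eq_zero_of_reduced (hr : IsRanking m n) (hI : I ≠ ⊤)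
    (hC : IsCharSet (I : Set (DiffPoly k m n)) C) {f : DiffPoly k m n} (hf : f ∈ I)
    (hred : ∀ g ∈ C, PartiallyReduced f g ∧ AlgReduced f g) : f = 0 := by
  by_contra hf0
  have hb : leader f ≠ ⊥ := by
    intro hb
    obtain ⟨a, rfl⟩ := eq_C_of_vars_eq_empty (leader_eq_bot_iff.1 hb)
    refine C_notMem hI (a := a) ?_ hf
    rintro rfl; simp at hf0
  obtain ⟨u, hu⟩ := exists_leader hb
  have hlow : ∀ g ∈ C, rk g < rk f → ∃ w : Deriv m n, leader g = ↑w ∧ w < u := by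
    intro g hg hlt
    obtain ⟨w, hw⟩ := exists_leader (hC.2.1.1 g hg)
    refine ⟨w, hw, ?_⟩
    rcases (rk_lt_rk_iff hw hu).1 hlt with h | ⟨rfl, h⟩
    · exact h
    · have := (hred g hg).2 w hw
      omega
  -- A nonzero reduced `f`, put after the elements of `C` of lower rank, would form an autoreduced
  -- set of lower rank than `C`.
  refine hC.2.2 (insert f {g ∈ C | rk g < rk f}) ?_ ⟨?_, ?_⟩ ⟨f, Set.mem_insert _ _, ?_, ?_⟩
  · rintro g (rfl | hg)
    · exact hf
    · exact hC.1 hg.1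
  · rintro g (rfl | hg)
    · exact hb
    · exact hC.2.1.1 g hg.1
  · rintro g (rfl | hg) h (rfl | hh) hne
    · exact absurd rfl hne
    · exact hred h hh.1
    · obtain ⟨w, hw, hwu⟩ := hlow g hg.1 hg.2
      refine ⟨fun u' hu' x hx => ?_, fun u' hu' => ?_⟩
      · rintro ⟨θ, _, rfl⟩
        have h1 := (leader_eq_coe_iff.1 hw).2 _ hx
        have h2 := hr.le_act θ u'
        rw [hu] at hu'
        rw [← WithBot.coe_injective hu'] at h1 h2
        exact absurd (h2.trans h1) (not_le.2 hwu)
      · rw [hu] at hu'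
        rw [← WithBot.coe_injective hu', degreeOf_eq_zero_of_leader_lt hw hwu]
        exact Nat.pos_of_ne_zero (degreeOf_leader_ne_zero hu)
    · exact hC.2.1.2 g hg.1 h hh.1 hne
  · rintro ⟨g, hg, hgr⟩
    obtain ⟨h1, h2⟩ := leader_eq_of_rk_eq hgr.symm hu
    have := (hred g hg).2 u h1
    omega
  · intro ρ hρ
    constructor
    · rintro ⟨g, (rfl | hg), rfl⟩
      · exact absurd hρ (lt_irrefl _)
      · exact ⟨g, hg.1, rfl⟩
    · rintro ⟨g, hg, rfl⟩
      exact ⟨g, Or.inr ⟨hg, hρ⟩, rfl⟩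

theorem Autoreduced.notMem_vars (hr : IsRanking m n) (hC : Autoreduced C) {f g : DiffPoly k m n}
    (hf : f ∈ C) (hg : g ∈ C) {u v : Deriv m n} (hu : leader g = ↑u)
    (hv : IsProperDerivative v u) : v ∉ f.vars := by
  intro hvf
  by_cases hfg : f = g
  · subst hfg
    obtain ⟨θ, hθ, rfl⟩ := hv
    exact absurd ((leader_eq_coe_iff.1 hu).2 _ hvf) (not_le.2 (hr.lt_act hθ u))
  · exact (hC.2 f hf g hg hfg).1 u hu v hvf hv

theorem Autoreduced.eq_of_leader_eq (hC : Autoreduced C) {f g : DiffPoly k m n} (hf : f ∈ C)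
    (hg : g ∈ C) {u : Deriv m n} (hfu : leader f = ↑u) (hgu : leader g = ↑u) : f = g := by
  by_contra hfg
  have h1 := (hC.2 f hf g hg hfg).2 u hgu
  have h2 := (hC.2 g hg f hf (Ne.symm hfg)).2 u hfu
  omega

theorem notMem_of_supported_compl_derivsOf (hr : IsRanking m n) (hI : I ≠ ⊤)
    (hC : IsCharSet (I : Set (DiffPoly k m n)) C) {p : DiffPoly k m n} (hp0 : p ≠ 0)
    (hp : p ∈ supported k (derivsOf (leaders C))ᶜ) : p ∉ I := by
  intro hpI
  refine hp0 (hC.eq_zero_of_reduced hr hI hpI fun g hg => ⟨fun u hu v hv => ?_, fun u hu => ?_⟩)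
  · rintro ⟨θ, _, rfl⟩
    exact mem_supported.1 hp hv ⟨u, ⟨g, hg, hu⟩, θ, rfl⟩
  · rw [degreeOf_eq_zero_of_supported hp (fun h => h ⟨u, ⟨g, hg, hu⟩, 0, (act_zero u).symm⟩)]
    exact Nat.pos_of_ne_zero (degreeOf_leader_ne_zero hu)

/-- The separant is nonzero in characteristic 0, and it is reduced with respect to `C`, including
`g` itself, whose degree in `u` has dropped. So it cannot lie in `I`. -/
theorem IsCharSet.hasSeparable [CharZero k] (hr : IsRanking m n) (hI : I ≠ ⊤)
    (hC : IsCharSet (I : Set (DiffPoly k m n)) C) {g : DiffPoly k m n} (hg : g ∈ C)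
    {u : Deriv m n} (hu : leader g = ↑u) : HasSeparable I u := by
  obtain ⟨h1, h2⟩ := leader_eq_coe_iff.1 hu
  refine ⟨g, hC.1 hg, h2, fun hs => pderiv_ne_zero h1 (hC.eq_zero_of_reduced hr hI hs ?_)⟩
  refine fun h hh => ⟨fun w hw x hx hp => ?_, fun w hw => ?_⟩
  · exact hC.2.1.notMem_vars hr hg hh hw hp (vars_pderiv_subset g u hx)
  · by_cases hgh : g = h
    · subst hgh
      have : u = w := WithBot.coe_injective (hu.symm.trans hw)
      subst this
      exact degreeOf_pderiv_lt (degreeOf_leader_ne_zero hu)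
    · exact (degreeOf_pderiv_le g u w).trans_lt ((hC.2.1.2 g hg h hh hgh).2 w hw)

theorem IsCanonicalCharSet.topCoeff_notMem (hr : IsRanking m n) (hI : I ≠ ⊤)
    (hC : IsCanonicalCharSet (I : Set (DiffPoly k m n)) C) {g : DiffPoly k m n} (hg : g ∈ C)
    {u : Deriv m n} (hu : leader g = ↑u) : topCoeff g u ∉ I := by
  refine notMem_of_supported_compl_derivsOf hr hI hC.1 (topCoeff_ne_zero ?_ u)
    ((hC.2 g hg).1 u hu)
  rintro rfl
  have := degreeOf_leader_ne_zero hu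
  simp at this

theorem IsCanonicalCharSet.leadRel (hr : IsRanking m n) (hI : I ≠ ⊤)
    (hC : IsCanonicalCharSet (I : Set (DiffPoly k m n)) C) {V : Set (Deriv m n)}
    {g : DiffPoly k m n} (hg : g ∈ C) (hgV : g ∈ supported k V) {u : Deriv m n}
    (hu : leader g = ↑u) : LeadRel I V u (g.degreeOf u) (topCoeff g u) (tail g u) :=
  LeadRel.of_leader (hC.1.1 hg) hgV hu (hC.topCoeff_notMem hr hI hg hu)

section Prime

variable [CharZero k] {d : Fin m → Derivation ℤ k k}

/-- An element of `I` that is minimal with respect to the algebraic leaders is not reduced with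
respect to the characteristic set. -/
theorem IsCanonicalCharSet.exists_of_isMinimalRel (hr : IsRanking m n) (hI : I ≠ ⊤)
    (hdI : IsDifferentialIdeal d I) (hC : IsCanonicalCharSet (I : Set (DiffPoly k m n)) C)
    {v : Deriv m n} {f : DiffPoly k m n} (hf : IsMinimalRel I Set.univ v f) :
    ∃ g ∈ C, ∃ u : Deriv m n, leader g = ↑u ∧
      (IsProperDerivative v u ∨ (u = v ∧ g.degreeOf v ≤ leadDegree I Set.univ v)) := by
  by_contra hc
  push Not at hc
  refine hf.ne_zero (hC.1.eq_zero_of_reduced hr hI hf.mem fun g hg => ⟨fun u hu y hy hp => ?_,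
    fun u hu => ?_⟩)
  · have hyv : y ≠ v := by rintro rfl; exact (hc g hg u hu).1 hp
    obtain ⟨θ, hθ, rfl⟩ := hp
    obtain ⟨s, r, h⟩ := (hC.1.hasSeparable hr hI hg hu).exists_leadRel_one hr hdI hθ
    -- A proper derivative of a leader of `C` has degree 1 modulo `I`, so unless it is `v` it cannot
    -- occur in `f` at all.
    have h1 := hf.reduced _ ⟨_, _, _, h⟩ hyv
    have h2 := h.leadDegree_le
    rw [mem_vars_iff_degreeOf] at hy
    omega
  · by_cases huv : u = v
    · subst huv
      rw [hf.degreeOf_eq]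
      exact (hc g hg u hu).2 rfl
    · have h := hC.leadRel hr hI hg (V := Set.univ) (by simp) hu
      exact (hf.reduced u ⟨_, _, _, h⟩ huv).trans_le h.leadDegree_le

theorem IsCanonicalCharSet.algLeaders_univ (hr : IsRanking m n) (hI : I.IsPrime)
    (hdI : IsDifferentialIdeal d I) (hC : IsCanonicalCharSet (I : Set (DiffPoly k m n)) C) :
    algLeaders I Set.univ ⊆ derivsOf (leaders C) := by
  have := hr.wellFoundedLT
  intro v hv
  obtain ⟨f, hf⟩ := exists_isMinimalRel hI hv
  obtain ⟨g, hg, u, hu, ⟨θ, _, rfl⟩ | ⟨rfl, _⟩⟩ := hC.exists_of_isMinimalRel hr hI.ne_top hdI hf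
  · exact ⟨u, ⟨g, hg, hu⟩, θ, rfl⟩
  · exact ⟨u, ⟨g, hg, hu⟩, 0, (act_zero u).symm⟩

/-- The element of `C` that obstructs a minimal relation of leader `u` must be `g`: since `C` is
autoreduced, `u` is not a proper derivative of a leader of `C`. -/
theorem IsCanonicalCharSet.degreeOf_le_leadDegree (hr : IsRanking m n) (hI : I.IsPrime)
    (hdI : IsDifferentialIdeal d I) (hC : IsCanonicalCharSet (I : Set (DiffPoly k m n)) C)
    {g : DiffPoly k m n} (hg : g ∈ C) {u : Deriv m n} (hu : leader g = ↑u) :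
    g.degreeOf u ≤ leadDegree I Set.univ u := by
  have := hr.wellFoundedLT
  have hrel := hC.leadRel hr hI.ne_top hg (V := Set.univ) (by simp) hu
  obtain ⟨f, hf⟩ := exists_isMinimalRel hI ⟨_, _, _, hrel⟩
  obtain ⟨h, hh, w, hw, hp | ⟨rfl, hle⟩⟩ := hC.exists_of_isMinimalRel hr hI.ne_top hdI hf
  · exact absurd (leader_eq_coe_iff.1 hu).1 (hC.1.2.1.notMem_vars hr hg hh hw hp)
  · rwa [hC.1.2.1.eq_of_leader_eq hg hh hu hw]

theorem IsCanonicalCharSet.subset_canonicalSet (hr : IsRanking m n) (hI : I.IsPrime)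
    (hdI : IsDifferentialIdeal d I) (hC : IsCanonicalCharSet (I : Set (DiffPoly k m n)) C)
    {V : Set (Deriv m n)} (hCV : C ⊆ algSection I V) : C ⊆ canonicalSet I V := by
  intro f hf
  have hauto := hC.1.2.1
  have hLC : algLeaders I V ⊆ derivsOf (leaders C) :=
    (algLeaders_mono (Set.subset_univ V)).trans (hC.algLeaders_univ hr hI hdI)
  have hrel : ∀ g ∈ C, ∀ u : Deriv m n, leader g = ↑u →
      LeadRel I V u (g.degreeOf u) (topCoeff g u) (tail g u) :=
    fun g hg u hu => hC.leadRel hr hI.ne_top hg (hCV hg).2 hu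
  -- The degree is squeezed: it is at most `leadDegree` over `ΘY`, which is at most `leadDegree`
  -- over `V`, and `g` is itself a relation over `V`.
  have hdeg : ∀ g ∈ C, ∀ u : Deriv m n, leader g = ↑u → g.degreeOf u = leadDegree I V u :=
    fun g hg u hu => le_antisymm ((hC.degreeOf_le_leadDegree hr hI hdI hg hu).trans
      (leadDegree_anti (Set.subset_univ V) ⟨_, _, _, hrel g hg u hu⟩))
      (hrel g hg u hu).leadDegree_le
  -- Autoreducedness lets the differential and the algebraic non-leaders be exchanged within `f`: a
  -- variable of `f` in `Θ(ld C)` is a leader of `C`, hence an algebraic leader over `V`.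
  have hvars : ∀ y ∈ f.vars, y ∈ derivsOf (leaders C) → y ∈ leaders C := by
    rintro _ hy ⟨u, ⟨g, hg, hu⟩, θ, rfl⟩
    by_cases hθ : θ = 0
    · rw [hθ, act_zero]; exact ⟨g, hg, hu⟩
    · exact absurd hy (hauto.notMem_vars hr hf hg hu ⟨θ, hθ, rfl⟩)
  obtain ⟨v, hv⟩ := exists_leader (hauto.1 f hf)
  obtain ⟨h1, h2, h3⟩ := hC.2 f hf
  refine ⟨v, ⟨_, _, _, hrel f hf v hv⟩, ⟨⟨hC.1.1 hf, (hCV hf).2, hv, hdeg f hf v hv, ?_, ?_⟩,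
    h2, fun p hp hpf => h3 p ?_ hpf⟩⟩
  · intro l hl hlv
    by_cases hlf : l ∈ f.vars
    · obtain ⟨g, hg, hgl⟩ := hvars l hlf (hLC hl)
      have hne : f ≠ g := by
        rintro rfl
        exact hlv (WithBot.coe_injective (hgl.symm.trans hv))
      rw [← hdeg g hg l hgl]
      exact (hauto.2 f hf g hg hne).2 l hgl
    · rw [degreeOf_eq_zero_of_notMem_vars hlf]
      exact leadDegree_pos hl
  · refine mem_supported.2 fun y hy => ⟨?_, fun hyL => mem_supported.1 (h1 v hv) hy (hLC hyL)⟩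
    exact mem_supported.1 (hCV hf).2 (vars_topCoeff_subset f v y hy).1
  · refine mem_supported.2 fun y hy hyC => (mem_supported.1 hp hy).2 ?_
    have hf0 : f ≠ 0 := by
      rintro rfl
      have := degreeOf_leader_ne_zero hv
      simp at this
    obtain ⟨g, hg, hgy⟩ := hvars y (vars_subset_of_dvd hpf hf0 hy) hyC
    exact ⟨_, _, _, hrel g hg y hgy⟩

end Prime

theorem Autoreduced.weakDTriangular (hC : Autoreduced C) : WeakDTriangular C := by
  refine ⟨hC.1, fun f hf g hg hfg u v hu hv θ huv => ?_⟩
  by_cases hθ : θ = 0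
  · rw [hθ, act_zero] at huv
    subst huv
    exact hfg (hC.eq_of_leader_eq hf hg hu hv)
  · exact (hC.2 f hf g hg hfg).1 v hv u (leader_eq_coe_iff.1 hu).1 ⟨θ, hθ, huv⟩

/-- The leader of the deciding `f` is `θ u` for a leader `u` of `C`. If `θ` is trivial, `f` is in
`C`; otherwise `T` has an element of leader `u`, as it shares the lower ranks of `C`, and is not
weak d-triangular. -/
theorem not_lowerRank_of_weakDTriangular (hr : IsRanking m n) (hI : I.IsPrime)
    {V : Set (Deriv m n)} {T : Set (DiffPoly k m n)} (hCD : C ⊆ canonicalSet I V)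
    (hL : algLeaders I V ⊆ derivsOf (leaders C)) (hT : T ⊆ canonicalSet I V)
    (hTw : WeakDTriangular T) : ¬ LowerRank T C := by
  rintro ⟨f, hf, hfr, hlow⟩
  obtain ⟨v, hv⟩ := exists_leader (hTw.1 f hf)
  obtain ⟨u, ⟨g, hg, hgu⟩, θ, rfl⟩ := hL (isCanonicalRel_of_mem_canonicalSet (hT hf) hv).1
  by_cases hθ : θ = 0
  · rw [hθ, act_zero] at hv
    have := eq_of_mem_canonicalSet hI (hT hf) (hCD hg) (hv.trans hgu.symm)
    exact hfr ⟨g, hg, by rw [this]⟩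
  · have hlt := hr.lt_act hθ u
    obtain ⟨h, hh, hhr⟩ := (hlow (rk g) ((rk_lt_rk_iff hgu hv).2 (Or.inl hlt))).2 ⟨g, hg, rfl⟩
    have hhu := (leader_eq_of_rk_eq hhr.symm hgu).1
    have hne : f ≠ h := by
      rintro rfl
      rw [hv] at hhu
      exact hlt.ne (WithBot.coe_injective hhu).symm
    exact hTw.2 f hf h hh hne _ u hv hhu θ rfl

theorem eq_of_image_rk_eq (hI : I.IsPrime) {V : Set (Deriv m n)} {A B : Set (DiffPoly k m n)}
    (hA : A ⊆ canonicalSet I V) (hB : B ⊆ canonicalSet I V) (h : rk '' A = rk '' B) : A = B := by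
  have key : ∀ {A B : Set (DiffPoly k m n)}, A ⊆ canonicalSet I V → B ⊆ canonicalSet I V →
      rk '' A = rk '' B → A ⊆ B := by
    intro A B hA hB h f hf
    obtain ⟨g, hg, hgr⟩ : rk f ∈ rk '' B := h ▸ ⟨f, hf, rfl⟩
    obtain ⟨v, hv⟩ := exists_leader (leader_ne_bot_of_mem_canonicalSet (hA hf))
    rwa [eq_of_mem_canonicalSet hI (hA hf) (hB hg)
      (hv.trans (leader_eq_of_rk_eq hgr.symm hv).1.symm)]
  exact (key hA hB h).antisymm (key hB hA h.symm)

end CharSet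

end DiffAlg

end

theorem lemmal {k : Type*} [Field k] [CharZero k] {m n : ℕ}
    (d : Fin m → Derivation ℤ k k) (hd : ∀ i j a, d i (d j a) = d j (d i a))
    [LinearOrder (DiffAlg.Deriv m n)] (hrank : DiffAlg.IsRanking m n)
    (I : Ideal (DiffAlg.DiffPoly k m n)) (hprime : I.IsPrime)
    (hI : DiffAlg.IsDifferentialIdeal d I)
    (C : Set (DiffAlg.DiffPoly k m n))
    (hC : DiffAlg.IsCanonicalCharSet (I : Set (DiffAlg.DiffPoly k m n)) C)
    (V : Set (DiffAlg.Deriv m n)) (hCV : C ⊆ DiffAlg.algSection I V) :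
    ∃ D : Set (DiffAlg.DiffPoly k m n),
      (∀ D' : Set (DiffAlg.DiffPoly k m n),
        DiffAlg.IsCanonicalAlgCharSet V (DiffAlg.algSection I V) D' ↔ D' = D) ∧
      C ⊆ D ∧
      ∀ T : Set (DiffAlg.DiffPoly k m n),
        DiffAlg.IsLeastWeakDTriangularSubset D T ↔ T = C := by
  have := hrank.wellFoundedLT
  have hCD := hC.subset_canonicalSet hrank hprime hI hCV
  have hL : DiffAlg.algLeaders I V ⊆ DiffAlg.derivsOf (DiffAlg.leaders C) :=
    (DiffAlg.algLeaders_mono (Set.subset_univ V)).trans (hC.algLeaders_univ hrank hprime hI)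
  have hleast : ∀ T ⊆ DiffAlg.canonicalSet I V, DiffAlg.WeakDTriangular T →
      ¬ DiffAlg.LowerRank T C := fun T hT hTw =>
    DiffAlg.not_lowerRank_of_weakDTriangular hrank hprime hCD hL hT hTw
  have hCw := hC.1.2.1.weakDTriangular
  refine ⟨DiffAlg.canonicalSet I V, fun D' => ⟨DiffAlg.eq_canonicalSet hprime, ?_⟩, hCD,
    fun T => ⟨fun hT => ?_, ?_⟩⟩
  · rintro rfl
    exact DiffAlg.isCanonicalAlgCharSet_canonicalSet hprime
  -- Two least sets have the same ranks, and a subset of `canonicalSet I V` is determined by its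
  -- ranks.
  · refine DiffAlg.eq_of_image_rk_eq hprime hT.1 hCD ?_
    by_contra hne
    rcases DiffAlg.lowerRank_or_lowerRank hne with h | h
    · exact hleast T hT.1 hT.2.1 h
    · exact hT.2.2 C hCD hCw h
  · rintro rfl
    exact ⟨hCD, hCw, hleast⟩
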